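/- **Setting.** Let $p,p^*>1$ with $1/p+1/p^*=1$. Let $X$ be a real Banach space that is $p$-convex (its modulus of convexity satisfies $\delta_X(\tau)\ge K\tau^p$ on $(0,2]$ for some $K>0$) and uniformly smooth, and let $Y_1,\dots,Y_N$ be uniformly smooth real Banach spaces. For a Banach space $E$ let $J_p^E(x)=\{\xi\in E^*:\langle \xi,x\rangle=\|x\|\|\xi\|,\ \|\xi\|=\|x\|^{p-1}\}$ denote the duality map with gauge $t\mapsto t^{p-1}$ (single-valued on the spaces at hand), and let $$D(z,w)=\tfrac1{p^*}\|z\|^p+\tfrac1p\|w\|^p-\langle J_p^X(z),w\rangle$$ be the Bregman distance on $X$. Let $G>0$ be a constant such that the corresponding Bregman distance $D_{X^*}(\xi,\eta)=\frac1p\|\xi\|^{p^*}+\frac1{p^*}\|\eta\|^{p^*}-\langle J_{p^*}^{X^*}(\xi),\eta\rangle$ on $X^*$ satisfies $D_{X^*}(\xi,\eta)\le \frac{G}{p^*}\|\eta-\xi\|^{p^*}$ for all $\xi,\eta\in X^*$. Let $S\subset X$ be closed and convex, let $F_i$ ($i=1,\dots,N$) be maps from a domain containing $S$ into $Y_i$,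 let $y=(y_1,\dots,y_N)\in Y_1\times\dots\times Y_N$, and let $x_0\in X$. Let $x^\dagger\in S$ be an $x_0$-minimum-distance solution, i.e. $F_i(x^\dagger)=y_i$ for all $i$, and $D(x_0,x^\dagger)\le D(x_0,x)$ for every $x\in S$ with $F_i(x)=y_i$ for all $i$. Let $0<\gamma<1/2$, $\omega>0$, $\Gamma\in\mathbb R$, and $$\nu=D(x_0,x^\dagger)+\tfrac{\omega^{-p}}{p}(1+\gamma)^p\,\Gamma .$$ Assume: 1. $\{z\in X: D(z,x^\dagger)\le\nu\}\subset S$; 2. each $F_i$ is continuously Fréchet differentiable on $S$, with $\|F_i'(x)\|\le L_i$ for all $x\in S$; put $L_{\max}=\max_i L_i$; 3. $\|F_i(x)-F_i(\tilde x)-F_i'(x)(x-\tilde x)\|\le\gamma\|F_i(x)-F_i(\tilde x)\|$ for all $i$ and all $x,\tilde x\in S$; 4. each $F_i$ is weak-to-weak (sequentially) continuous on $S$; 5. $\bigcap_i\ker F_i'(x^\dagger)\subset\bigcap_i\ker F_i'(x)$ for all $x\in S$. **Noisy data and iteration.** For every $\delta>0$ let $y^\delta$ satisfy $\|y_i-y_i^\delta\|\le\delta$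 for all $i$. Let $i_1,i_2,\dots$ be independent random indices, uniformly distributed on $\{1,\dots,N\}$, let $\mu_1,\mu_2,\ldots>0$, and let $x_0^\delta=x_0$, $$x_{k+1}^\delta=J_{p^*}^{X^*}\Big(J_p^X(x_k^\delta)-\mu_{k+1}\,F_{i_{k+1}}'(x_k^\delta)^*J_p^{Y_{i_{k+1}}}\big(F_{i_{k+1}}(x_k^\delta)-y_{i_{k+1}}^\delta\big)\Big),\qquad k\ge0,$$ where $X^{**}$ is identified with $X$ (the $F_i$ may be extended arbitrarily outside $S$; this does not affect the limit below). **Theorem.** Suppose that $\sum_{k\ge1}\mu_k=\infty$ and that for some $C>0$ $$1-\gamma-L_{\max}^{p^*}\tfrac{G}{p^*}\mu_\ell^{p^*-1}-\tfrac{p-1}{p^2}\omega^{p^*}\ge C\qquad\text{for all }\ell\ge1 .$$ Let the stopping indices $k(\delta)\in\mathbb N$ satisfy $\delta^p\sum_{\ell=1}^{k(\delta)}\mu_\ell\le\Gamma$ for all sufficiently small $\delta>0$, $\lim_{\delta\searrow0}k(\delta)=\infty$, and $\lim_{\delta\searrow0}\delta^p\sum_{\ell=1}^{k(\delta)}\mu_\ell=0$.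 Then $D(x_{k(\delta)}^\delta,x^\dagger)$ is integrable for every $\delta>0$, and $$\lim_{\delta\searrow0}\mathbb E\big[D(x_{k(\delta)}^\delta,x^\dagger)\big]=0 .$$ -/

import Mathlib

open Filter Topology MeasureTheory ProbabilityTheory

namespace SGDBanach

noncomputable section

/-! ### Geometry of Banach spaces -/

/-- Modulus of convexity: the infimum of `1 - ‖z + w‖ / 2` over unit vectors `z`, `w` with
`‖z - w‖ ≥ τ`, as an extended real (so that the infimum over the empty set is `+∞`). -/
def convexityModulus (E : Type*) [NormedAddCommGroup E] (τ : ℝ) : EReal :=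
  ⨅ (z : E) (w : E) (_ : ‖z‖ = 1) (_ : ‖w‖ = 1) (_ : τ ≤ ‖z - w‖),
    ((1 - ‖z + w‖ / 2 : ℝ) : EReal)

/-- `E` is `p`-convex: the modulus of convexity is at least `K τ ^ p` on `(0, 2]`,
for some `K > 0`. -/
def IsPConvex (p : ℝ) (E : Type*) [NormedAddCommGroup E] : Prop :=
  1 < p ∧ ∃ K : ℝ, 0 < K ∧
    ∀ τ : ℝ, 0 < τ → τ ≤ 2 → ((K * τ ^ p : ℝ) : EReal) ≤ convexityModulus E τ

/-- Modulus of smoothness. The set is bounded above by `τ` for `τ ≥ 0`. -/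
def smoothnessModulus (E : Type*) [NormedAddCommGroup E] [NormedSpace ℝ E] (τ : ℝ) : ℝ :=
  sSup {d : ℝ | ∃ z w : E, ‖z‖ = 1 ∧ ‖w‖ = 1 ∧ d = (‖z + τ • w‖ + ‖z - τ • w‖) / 2 - 1}

/-- `E` is uniformly smooth. -/
def IsUniformlySmooth (E : Type*) [NormedAddCommGroup E] [NormedSpace ℝ E] : Prop :=
  Tendsto (fun τ : ℝ => smoothnessModulus E τ / τ) (𝓝[>] 0) (𝓝 0)

/-! ### Duality maps and Bregman distances -/

section Duality

variable {E : Type*} [NormedAddCommGroup E] [NormedSpace ℝ E]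

/-- The set-valued duality map with gauge function `t ↦ t ^ (p - 1)`. -/
def dualityMap (p : ℝ) (x : E) : Set (StrongDual ℝ E) :=
  {f | f x = ‖x‖ * ‖f‖ ∧ ‖x‖ ^ (p - 1) = ‖f‖}

/-- A single-valued selection of the duality map (the duality map itself if `E` is smooth). -/
def dualitySel (p : ℝ) (x : E) : StrongDual ℝ E :=
  Classical.epsilon fun f => f ∈ dualityMap p x

/-- The duality map with gauge `t ↦ t ^ (r - 1)` of the dual space, with values in `E` through
the canonical embedding of `E` in its bidual (which is onto for reflexive `E`). -/
def dualitySelDual (r : ℝ) (ξ : StrongDual ℝ E) : E :=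
  Classical.epsilon fun x : E =>
    NormedSpace.inclusionInDoubleDual ℝ E x ∈ dualityMap r ξ

/-- The Bregman distance
`D(z, w) = ‖z‖ ^ p / p* + ‖w‖ ^ p / p - ⟨J_p z, w⟩`, where `1 / p + 1 / p* = 1`. -/
def bregman (p : ℝ) (z w : E) : ℝ :=
  1 / p.conjExponent * ‖z‖ ^ p + 1 / p * ‖w‖ ^ p - dualitySel p z w

/-- The closed Bregman ball of radius `ν` around `x`. -/
def bregmanBall (p ν : ℝ) (x : E) : Set E := {z | bregman p z x ≤ ν}

end Duality

/-- Weak-to-weak (sequential) continuity on the set `S`. -/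
def WeakToWeakContinuousOn {E G : Type*} [NormedAddCommGroup E] [NormedSpace ℝ E]
    [NormedAddCommGroup G] [NormedSpace ℝ G] (f : E → G) (S : Set E) : Prop :=
  ∀ (u : ℕ → E) (x : E), (∀ n, u n ∈ S) → x ∈ S →
    (∀ φ : StrongDual ℝ E, Tendsto (fun n => φ (u n)) atTop (𝓝 (φ x))) →
    ∀ ψ : StrongDual ℝ G, Tendsto (fun n => ψ (f (u n))) atTop (𝓝 (ψ (f x)))

/-! ### The system of equations and stochastic gradient descent -/

section SGD

variable {X : Type*} [NormedAddCommGroup X] [NormedSpace ℝ X]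
  {N : ℕ} {Y : Fin N → Type*} [∀ i, NormedAddCommGroup (Y i)] [∀ i, NormedSpace ℝ (Y i)]

/-- `xs` is an `x₀`-minimum-distance solution in `S` of the system `F i x = y i`. -/
def IsMinDistSolution (p : ℝ) (S : Set X) (F : ∀ i, X → Y i) (y : ∀ i, Y i)
    (x₀ xs : X) : Prop :=
  xs ∈ S ∧ (∀ i, F i xs = y i) ∧
    ∀ x ∈ S, (∀ i, F i x = y i) → bregman p x₀ xs ≤ bregman p x₀ x

/-- The stochastic gradient `F_i'(x)^* J_p(F_i(x) - y_i)`; the adjoint of a bounded linear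
operator `A` is `ξ ↦ ξ ∘ A`. -/
def sgdGradient (p : ℝ) (F : ∀ i, X → Y i) (F' : ∀ i, X → X →L[ℝ] Y i) (y : ∀ i, Y i)
    (x : X) (i : Fin N) : StrongDual ℝ X :=
  (dualitySel p (F i x - y i)).comp (F' i x)

/-- The iterates
`x_{k+1} = J_{p*}^{X*} (J_p(x_k) - μ_{k+1} F_i'(x_k)^* J_p(F_i(x_k) - y_i))`, `i = i_{k+1}`,
of stochastic gradient descent for data `y`, along the index sequence `i`. -/
def sgdIterate (p : ℝ) (F : ∀ i, X → Y i) (F' : ∀ i, X → X →L[ℝ] Y i) (y : ∀ i, Y i)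
    (μ : ℕ → ℝ) (x₀ : X) (i : ℕ → Fin N) : ℕ → X
  | 0 => x₀
  | k + 1 =>
      dualitySelDual p.conjExponent
        (dualitySel p (sgdIterate p F F' y μ x₀ i k) -
          μ (k + 1) • sgdGradient p F F' y (sgdIterate p F F' y μ x₀ i k) (i (k + 1)))

end SGD

end

end SGDBanach

/-! Consider exact data first. In the dual variable the iteration is a plain step, `J x_{k+1} = J
x_k - μ_{k+1} g_k`. The power bound on the Bregman distance of `X*` and the cone condition make each
step lower `D(x_k, x†)` by a multiple of `μ_{k+1} ‖F_i(x_k) - y_i‖^p` (`exists_bregman_step_le`).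
The next index is independent of the past, so `d_k = E D(x_k, x†)` and the expected total residual
`e_k` satisfy `d_k - d_{k+1} ≥ κ μ_{k+1} e_k`. Since `∑ μ = ∞`, `e` takes arbitrarily small values,
and `d` decreases to some limit `d_∞`.

To get `d_∞ = 0`, fix `l` and take the first `k ≥ l` at which `e_k` is below a small threshold; then
`e_k ≤ e_m` for `l ≤ m < k`. Now `D(x_k, x†) ≤ ⟨J x_k - J x†, x_k - x†⟩`, and the functional splits
as `(J x_l - J x†) + (J x_k - J x_l)`. The second part is a sum of gradient steps; its expected
pairing is at most `A (d_l - d_k)`, because `e_k ≤ e_m`. The first part annihilates the common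
kernel of the `F_i'(x†)`, by minimality of `x†` and the kernel inclusion. As `X` is reflexive, it is
a norm limit of sums of adjoint images, so its pairing is at most `ε + Q · residual`
(`exists_apply_sub_le`); one `Q` serves all paths, since there are finitely many index words of
length `l`. Hence `d_∞ ≤ A (d_l - d_∞)`, and `l → ∞` concludes
(`tendsto_zero_of_le_at_running_minima`).

With noise, the decrease holds up to `M μ δ^p`. Choose `n` with `d_n` small. For this fixed `n` the
iterate depends continuously on the data, and from `n` to `k(δ)` the distance grows by at most `M
δ^p ∑ μ → 0`. -/

namespace SGDBanach

/-! ### Duality maps and elementary properties of the Bregman distance. -/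

section DualityMaps

variable {E : Type*} [NormedAddCommGroup E] [NormedSpace ℝ E] {p p' : ℝ}

theorem dualityMap_nonempty (hp : 1 < p) (x : E) : (dualityMap p x).Nonempty := by
  rcases eq_or_ne x 0 with rfl | hx
  · exact ⟨0, by simp [dualityMap, Real.zero_rpow (sub_pos.2 hp).ne']⟩
  · obtain ⟨g, hg, hgx⟩ := exists_dual_vector ℝ x (norm_ne_zero_iff.2 hx)
    have h0 : 0 ≤ ‖x‖ ^ (p - 1) := by positivity
    refine ⟨‖x‖ ^ (p - 1) • g, ?_, ?_⟩
    · simp only [smul_apply, norm_smul, hg, hgx, smul_eq_mul,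
        Real.norm_of_nonneg h0, RCLike.ofReal_real_eq_id, id]
      ring
    · simp [norm_smul, hg, abs_of_nonneg h0]

theorem dualitySel_mem (hp : 1 < p) (x : E) : dualitySel p x ∈ dualityMap p x :=
  Classical.epsilon_spec (dualityMap_nonempty hp x)

theorem norm_dualitySel (hp : 1 < p) (x : E) : ‖dualitySel p x‖ = ‖x‖ ^ (p - 1) :=
  (dualitySel_mem hp x).2.symm

theorem norm_mul_rpow_sub_one {E : Type*} [NormedAddCommGroup E] {p : ℝ} (hp : 1 < p)
    (x : E) : ‖x‖ * ‖x‖ ^ (p - 1) = ‖x‖ ^ p := by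
  conv_rhs => rw [show p = 1 + (p - 1) by ring,
    Real.rpow_add' (norm_nonneg x) (by linarith), Real.rpow_one]

theorem apply_self_of_mem_dualityMap (hp : 1 < p) {x : E} {f : StrongDual ℝ E}
    (hf : f ∈ dualityMap p x) : f x = ‖x‖ ^ p := by
  rw [hf.1, ← hf.2, norm_mul_rpow_sub_one hp]

theorem dualitySel_zero (hp : 1 < p) : dualitySel p (0 : E) = 0 := by
  rw [← norm_eq_zero, norm_dualitySel hp, norm_zero, Real.zero_rpow (sub_pos.2 hp).ne']

theorem rpow_sub_one_rpow (hpp' : p.HolderConjugate p') {a : ℝ} (ha : 0 ≤ a) :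
    (a ^ (p - 1)) ^ p' = a ^ p := by
  rw [← Real.rpow_mul ha, hpp'.sub_one_mul_conj]

theorem rpow_sub_one_rpow_sub_one (hpp' : p.HolderConjugate p') {a : ℝ} (ha : 0 ≤ a) :
    (a ^ (p - 1)) ^ (p' - 1) = a := by
  rw [← Real.rpow_mul ha, show (p - 1) * (p' - 1) = 1 by
    have := hpp'.sub_one_mul_conj; linarith, Real.rpow_one]

/-- Elements of the duality map are subgradients of `‖·‖ ^ p / p`. -/
theorem subgradient_of_mem_dualityMap (hpp' : p.HolderConjugate p') {x : E} {f : StrongDual ℝ E}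
    (hf : f ∈ dualityMap p x) (w : E) : ‖x‖ ^ p / p + f (w - x) ≤ ‖w‖ ^ p / p := by
  have h1 : f w ≤ ‖x‖ ^ (p - 1) * ‖w‖ := by
    rw [hf.2]; exact (le_abs_self _).trans (f.le_opNorm w)
  have h2 := Real.young_inequality_of_nonneg (norm_nonneg w)
    (Real.rpow_nonneg (norm_nonneg x) (p - 1)) hpp'
  rw [rpow_sub_one_rpow hpp' (norm_nonneg x)] at h2
  have h3 : ‖x‖ ^ p / p' = ‖x‖ ^ p - ‖x‖ ^ p / p := by
    rw [div_eq_mul_inv, div_eq_mul_inv, ← hpp'.one_sub_inv]; ring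
  rw [map_sub, apply_self_of_mem_dualityMap hpp'.lt hf]
  linarith

theorem bregman_eq (hpp' : p.HolderConjugate p') (z w : E) :
    bregman p z w = 1 / p' * ‖z‖ ^ p + 1 / p * ‖w‖ ^ p - dualitySel p z w := by
  rw [bregman, hpp'.conjExponent_eq]

theorem bregman_eq_sub (hpp' : p.HolderConjugate p') (z w : E) :
    bregman p z w = ‖w‖ ^ p / p - ‖z‖ ^ p / p - dualitySel p z (w - z) := by
  rw [bregman_eq hpp', map_sub, apply_self_of_mem_dualityMap hpp'.lt (dualitySel_mem hpp'.lt z),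
    one_div, one_div, ← hpp'.one_sub_inv]
  ring

theorem bregman_nonneg (hpp' : p.HolderConjugate p') (z w : E) : 0 ≤ bregman p z w := by
  have := subgradient_of_mem_dualityMap hpp' (dualitySel_mem hpp'.lt z) w
  rw [bregman_eq_sub hpp']
  linarith

theorem bregman_self (hpp' : p.HolderConjugate p') (z : E) : bregman p z z = 0 := by
  simp [bregman_eq_sub hpp']

theorem bregman_le_sub_apply_sub (hpp' : p.HolderConjugate p') (z w : E) :
    bregman p z w ≤ (dualitySel p z - dualitySel p w) (z - w) := by
  have := bregman_nonneg hpp' w z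
  rw [bregman_eq_sub hpp'] at this ⊢
  have h1 : dualitySel p z (w - z) = -dualitySel p z (z - w) := by rw [← map_neg, neg_sub]
  rw [sub_apply]
  linarith

/-- The Bregman distance is coercive in its first argument. -/
theorem norm_le_of_bregman_le (hpp' : p.HolderConjugate p') (w : E) (r : ℝ) :
    ∃ B : ℝ, ∀ z : E, bregman p z w ≤ r → ‖z‖ ≤ B := by
  have hp := hpp'.pos
  have hp' := hpp'.symm.pos
  -- Beyond the first bound the pairing term uses at most half of `‖z‖ ^ p / p'`; beyond the second
  -- the other half exceeds `|r|`.
  refine ⟨max (2 * p' * ‖w‖) ((2 * p' * |r|) ^ p⁻¹), fun z hz => ?_⟩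
  by_contra! hlt
  obtain ⟨h1, h2⟩ := max_lt_iff.1 hlt
  have h3 : 2 * p' * |r| < ‖z‖ ^ p :=
    (Real.rpow_inv_lt_iff_of_pos (by positivity) (norm_nonneg z) hp).1 h2
  have h4 : dualitySel p z w ≤ ‖z‖ ^ (p - 1) * ‖w‖ := by
    rw [← norm_dualitySel hpp'.lt]
    exact (le_abs_self _).trans ((dualitySel p z).le_opNorm w)
  have h5 : ‖z‖ ^ (p - 1) * (2 * p' * ‖w‖) ≤ ‖z‖ ^ (p - 1) * ‖z‖ := by gcongr
  rw [mul_comm _ ‖z‖, norm_mul_rpow_sub_one hpp'.lt] at h5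
  rw [bregman_eq hpp'] at hz
  have h6 : 0 ≤ 1 / p * ‖w‖ ^ p := by positivity
  have h7 : 1 / p' * ‖z‖ ^ p * (2 * p') = 2 * ‖z‖ ^ p := by field_simp
  have h8 : 1 / p' * ‖z‖ ^ p - ‖z‖ ^ (p - 1) * ‖w‖ ≤ |r| := by
    linarith [le_abs_self r]
  have h9 := mul_le_mul_of_nonneg_right h8 (by positivity : 0 ≤ 2 * p')
  nlinarith

end DualityMaps

/-! ### Uniform smoothness and continuity of the duality map. -/

section UniformlySmooth

variable {E : Type*} [NormedAddCommGroup E] [NormedSpace ℝ E] {p p' : ℝ}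

theorem le_smoothnessModulus {τ : ℝ} (hτ : 0 ≤ τ) {z w : E} (hz : ‖z‖ = 1) (hw : ‖w‖ = 1) :
    ‖z + τ • w‖ + ‖z - τ • w‖ ≤ 2 + 2 * smoothnessModulus E τ := by
  have : (‖z + τ • w‖ + ‖z - τ • w‖) / 2 - 1 ≤ smoothnessModulus E τ := by
    refine le_csSup ⟨τ, ?_⟩ ⟨z, w, hz, hw, rfl⟩
    rintro d ⟨z, w, hz, hw, rfl⟩
    have h1 := norm_add_le z (τ • w)
    have h2 := norm_sub_le z (τ • w)
    rw [norm_smul, Real.norm_of_nonneg hτ, hz, hw] at h1 h2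
    linarith
  linarith

/-- In a uniformly smooth space, functionals in the unit ball of the dual which almost attain the
value one at a common unit vector are close to each other. -/
theorem IsUniformlySmooth.exists_norm_sub_le (hE : IsUniformlySmooth E) {ε : ℝ} (hε : 0 < ε) :
    ∃ η > 0, ∀ (x : E) (f g : StrongDual ℝ E), ‖x‖ = 1 → ‖f‖ ≤ 1 → ‖g‖ ≤ 1 →
      2 - η ≤ f x + g x → ‖f - g‖ ≤ ε := by
  have h := (hE.eventually (gt_mem_nhds (show (0 : ℝ) < ε / 4 by positivity))).and
    self_mem_nhdsWithin
  obtain ⟨τ, hτε, hτ⟩ := h.exists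
  have hτ : 0 < τ := hτ
  rw [div_lt_iff₀ hτ] at hτε
  -- Adding `f (x + τ w) ≤ ‖x + τ w‖` and `g (x - τ w) ≤ ‖x - τ w‖` gives `τ (f - g) w ≤ η + 2
  -- ρ(τ)`, with `ρ` the modulus of smoothness; each term is at most `τ ε / 2`.
  refine ⟨τ * ε / 2, by positivity, fun x f g hx hf hg hfg => ?_⟩
  have key : ∀ w : E, ‖w‖ = 1 → (f - g) w ≤ ε := fun w hw => by
    have h1 := le_smoothnessModulus hτ.le hx hw
    have h2 : f (x + τ • w) ≤ ‖x + τ • w‖ :=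
      (le_abs_self _).trans (f.le_of_opNorm_le_of_le hf le_rfl |>.trans_eq (one_mul _))
    have h3 : g (x - τ • w) ≤ ‖x - τ • w‖ :=
      (le_abs_self _).trans (g.le_of_opNorm_le_of_le hg le_rfl |>.trans_eq (one_mul _))
    rw [map_add, map_smul, smul_eq_mul] at h2
    rw [map_sub, map_smul, smul_eq_mul] at h3
    rw [sub_apply]
    refine le_of_mul_le_mul_left ?_ hτ
    nlinarith
  refine ContinuousLinearMap.opNorm_le_bound _ hε.le fun v => ?_
  rcases eq_or_ne v 0 with rfl | hv
  · simp
  have hv' : 0 < ‖v‖ := norm_pos_iff.2 hv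
  have hu : ‖‖v‖⁻¹ • v‖ = 1 := by rw [norm_smul, norm_inv, norm_norm, inv_mul_cancel₀ hv'.ne']
  have h1 := key _ hu
  have h2 := key (-(‖v‖⁻¹ • v)) (by rw [norm_neg, hu])
  rw [map_neg] at h2
  rw [map_smul, smul_eq_mul] at h1 h2
  have h3 : |‖v‖⁻¹ * (f - g) v| ≤ ε := abs_le.2 ⟨by linarith, h1⟩
  rw [abs_mul, abs_inv, abs_norm, inv_mul_le_iff₀ hv'] at h3
  rw [Real.norm_eq_abs]
  linarith

theorem IsUniformlySmooth.eq_of_apply_eq (hE : IsUniformlySmooth E) {x : E} (hx : x ≠ 0)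
    {f g : StrongDual ℝ E} (hf : f x = ‖x‖ * ‖f‖) (hg : g x = ‖x‖ * ‖g‖) (hfg : ‖f‖ = ‖g‖) :
    f = g := by
  rcases eq_or_ne f 0 with rfl | hf0
  · rw [norm_zero] at hfg
    exact (norm_eq_zero.1 hfg.symm).symm
  have hf' : 0 < ‖f‖ := norm_pos_iff.2 hf0
  have hx' : 0 < ‖x‖ := norm_pos_iff.2 hx
  suffices h : ‖f‖⁻¹ • f - ‖f‖⁻¹ • g = 0 by
    exact smul_right_injective _ (inv_ne_zero hf'.ne') (sub_eq_zero.1 h)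
  rw [← norm_le_zero_iff]
  refine le_of_forall_pos_le_add fun ε hε => ?_
  obtain ⟨η, hη, h⟩ := hE.exists_norm_sub_le hε
  rw [zero_add]
  refine h (‖x‖⁻¹ • x) _ _ ?_ ?_ ?_ ?_
  · rw [norm_smul, norm_inv, norm_norm, inv_mul_cancel₀ hx'.ne']
  · rw [norm_smul, norm_inv, norm_norm, inv_mul_cancel₀ hf'.ne']
  · rw [norm_smul, norm_inv, norm_norm, ← hfg, inv_mul_cancel₀ hf'.ne']
  · simp only [smul_apply, map_smul, smul_eq_mul, hf, hg, ← hfg]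
    have : ‖x‖⁻¹ * (‖f‖⁻¹ * (‖x‖ * ‖f‖)) = 1 := by field_simp
    rw [this]
    linarith

theorem IsUniformlySmooth.dualitySel_eq (hE : IsUniformlySmooth E) (hp : 1 < p) {x : E}
    {f : StrongDual ℝ E} (hf : f ∈ dualityMap p x) : dualitySel p x = f := by
  have hJ := dualitySel_mem hp x
  rcases eq_or_ne x 0 with rfl | hx
  · rw [dualitySel_zero hp, eq_comm, ← norm_eq_zero, ← hf.2, norm_zero,
      Real.zero_rpow (sub_pos.2 hp).ne']
  · exact hE.eq_of_apply_eq hx hJ.1 hf.1 (hJ.2.symm.trans hf.2)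

/-- On a uniformly smooth space the duality map is norm-to-norm continuous. -/
theorem IsUniformlySmooth.continuous_dualitySel (hE : IsUniformlySmooth E) (hp : 1 < p) :
    Continuous (dualitySel p : E → StrongDual ℝ E) := by
  rw [continuous_iff_continuousAt]
  intro x
  have hp' : 0 < p - 1 := sub_pos.2 hp
  have hpow : Tendsto (fun u : E => ‖u‖ ^ (p - 1)) (𝓝 x) (𝓝 (‖x‖ ^ (p - 1))) :=
    (continuous_norm.rpow_const fun _ => Or.inr hp'.le).tendsto x
  rcases eq_or_ne x 0 with rfl | hx
  · rw [ContinuousAt, dualitySel_zero hp]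
    refine tendsto_zero_iff_norm_tendsto_zero.2 ?_
    simp only [norm_dualitySel hp]
    rwa [norm_zero, Real.zero_rpow hp'.ne'] at hpow
  -- Normalised duality images: for `u` near `x`, both `f u` and `f x` almost attain one at `x /
  -- ‖x‖`, which forces them together.
  set f : E → StrongDual ℝ E := fun u => (‖u‖ ^ (p - 1))⁻¹ • dualitySel p u with hfdef
  have hx' : 0 < ‖x‖ := norm_pos_iff.2 hx
  have hne : ∀ᶠ u in 𝓝 x, u ≠ 0 := eventually_ne_nhds hx
  have hfn : ∀ u : E, u ≠ 0 → ‖f u‖ = 1 := fun u hu => by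
    have : 0 < ‖u‖ ^ (p - 1) := Real.rpow_pos_of_pos (norm_pos_iff.2 hu) _
    rw [hfdef, norm_smul, norm_dualitySel hp, norm_inv, Real.norm_of_nonneg this.le,
      inv_mul_cancel₀ this.ne']
  have hfa : ∀ u : E, u ≠ 0 → f u u = ‖u‖ := fun u hu => by
    have : 0 < ‖u‖ ^ (p - 1) := Real.rpow_pos_of_pos (norm_pos_iff.2 hu) _
    simp only [hfdef, smul_apply, smul_eq_mul,
      apply_self_of_mem_dualityMap hp (dualitySel_mem hp u), ← norm_mul_rpow_sub_one hp u]
    field_simp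
  have hfc : Tendsto f (𝓝 x) (𝓝 (f x)) := by
    rw [Metric.tendsto_nhds]
    intro ε hε
    obtain ⟨η, hη, h⟩ := hE.exists_norm_sub_le (half_pos hε)
    have hnear : ∀ᶠ u in 𝓝 x, 2 * ‖x - u‖ < η * ‖x‖ := by
      have : Tendsto (fun u => 2 * ‖x - u‖) (𝓝 x) (𝓝 (2 * ‖x - x‖)) := by
        apply Continuous.tendsto; fun_prop
      refine this.eventually (gt_mem_nhds ?_)
      simpa using mul_pos hη hx'
    filter_upwards [hne, hnear] with u hu hun
    rw [dist_eq_norm]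
    refine (h (‖x‖⁻¹ • x) _ _ ?_ (hfn u hu).le (hfn x hx).le ?_).trans_lt (half_lt_self hε)
    · rw [norm_smul, norm_inv, norm_norm, inv_mul_cancel₀ hx'.ne']
    · have h1 : f u (x - u) ≥ -‖x - u‖ := by
        have := (f u).le_opNorm (x - u)
        rw [hfn u hu, one_mul] at this
        exact (abs_le.1 this).1
      rw [map_sub, hfa u hu] at h1
      have h2 : ‖x‖ - ‖u‖ ≤ ‖x - u‖ := norm_sub_norm_le x u
      rw [map_smul, map_smul, smul_eq_mul, smul_eq_mul, hfa x hx, ← mul_add,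
        le_inv_mul_iff₀ hx']
      linarith
  have heq : ∀ u : E, u ≠ 0 → ‖u‖ ^ (p - 1) • f u = dualitySel p u := fun u hu => by
    have : 0 < ‖u‖ ^ (p - 1) := Real.rpow_pos_of_pos (norm_pos_iff.2 hu) _
    rw [hfdef, smul_smul, mul_inv_cancel₀ this.ne', one_smul]
  rw [ContinuousAt, ← heq x hx]
  refine (hpow.smul hfc).congr' ?_
  filter_upwards [hne] with u hu using heq u hu

theorem IsUniformlySmooth.continuous_bregman_left (hE : IsUniformlySmooth E)
    (hpp' : p.HolderConjugate p') (w : E) : Continuous fun z : E => bregman p z w := by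
  simp only [bregman_eq hpp']
  have h1 := hE.continuous_dualitySel hpp'.lt
  have h2 : Continuous fun z : E => ‖z‖ ^ p :=
    continuous_norm.rpow_const fun _ => Or.inr hpp'.pos.le
  have h3 : Continuous fun z : E => dualitySel p z w := h1.clm_apply continuous_const
  fun_prop

end UniformlySmooth

/-! ### Uniform convexity and norm attainment. -/

section UniformlyConvex

variable {E : Type*} [NormedAddCommGroup E] [NormedSpace ℝ E]

theorem IsPConvex.uniformConvexSpace {E : Type*} [NormedAddCommGroup E] {p : ℝ}
    (hE : IsPConvex p E) : UniformConvexSpace E where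
  uniform_convex ε hε := by
    obtain ⟨-, K, hK, h⟩ := hE
    have hτ : 0 < min ε 2 := lt_min hε two_pos
    refine ⟨2 * (K * min ε 2 ^ p), by positivity, fun x hx y hy hxy => ?_⟩
    have h1 : convexityModulus E (min ε 2) ≤ ((1 - ‖x + y‖ / 2 : ℝ) : EReal) :=
      iInf_le_of_le x <| iInf_le_of_le y <| iInf_le_of_le hx <| iInf_le_of_le hy <|
        iInf_le_of_le ((min_le_left _ _).trans hxy) le_rfl
    have h2 := EReal.coe_le_coe_iff.1 ((h _ hτ (min_le_right _ _)).trans h1)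
    linarith

theorem exists_unit_lt_apply {f : StrongDual ℝ E} {r : ℝ} (hr : 0 ≤ r) (hrf : r < ‖f‖) :
    ∃ x : E, ‖x‖ = 1 ∧ r < f x := by
  obtain ⟨x, hx⟩ : ∃ x : E, r * ‖x‖ < ‖f x‖ := by
    by_contra! h
    exact hrf.not_ge (f.opNorm_le_bound hr h)
  have hx0 : x ≠ 0 := by rintro rfl; simp at hx
  have hx' : 0 < ‖x‖ := norm_pos_iff.2 hx0
  have h1 : ‖‖x‖⁻¹ • x‖ = 1 := by rw [norm_smul, norm_inv, norm_norm, inv_mul_cancel₀ hx'.ne']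
  have h2 : r < ‖x‖⁻¹ * |f x| := by rwa [lt_inv_mul_iff₀ hx', mul_comm]
  rcases abs_cases (f x) with ⟨h, -⟩ | ⟨h, -⟩
  · exact ⟨‖x‖⁻¹ • x, h1, by rwa [map_smul, smul_eq_mul, ← h]⟩
  · exact ⟨-(‖x‖⁻¹ • x), by rw [norm_neg, h1],
      by rwa [map_neg, map_smul, smul_eq_mul, ← mul_neg, ← h]⟩

/-- A bounded linear functional on a uniformly convex Banach space attains its norm. -/
theorem exists_norm_eq_one_apply_eq_norm [CompleteSpace E] [UniformConvexSpace E]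
    {f : StrongDual ℝ E} (hf : f ≠ 0) : ∃ x : E, ‖x‖ = 1 ∧ f x = ‖f‖ := by
  have hf' : 0 < ‖f‖ := norm_pos_iff.2 hf
  have hex : ∀ n : ℕ, ∃ x : E, ‖x‖ = 1 ∧ ‖f‖ * (1 - 1 / ((n : ℝ) + 1)) < f x := fun n => by
    have h1 : 1 / ((n : ℝ) + 1) ≤ 1 := by
      rw [div_le_one (by positivity)]
      linarith [n.cast_nonneg (α := ℝ)]
    have h2 : 0 < 1 / ((n : ℝ) + 1) := by positivity
    refine exists_unit_lt_apply (mul_nonneg hf'.le (by linarith)) ?_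
    exact mul_lt_of_lt_one_right hf' (by linarith)
  choose u hu hfu using hex
  have hlim : Tendsto (fun n : ℕ => 1 / ((n : ℝ) + 1)) atTop (𝓝 0) :=
    tendsto_one_div_add_atTop_nhds_zero_nat
  -- Two almost maximisers far apart would have a sum of norm at most `2 - η`, too short for `f` to
  -- be nearly `2 ‖f‖` there.
  have hcau : CauchySeq u := by
    rw [Metric.cauchySeq_iff']
    intro ε hε
    obtain ⟨η, hη, h⟩ := exists_forall_sphere_dist_add_le_two_sub E hε
    obtain ⟨M, hM⟩ := (hlim.eventually (gt_mem_nhds (half_pos hη))).exists_forall_of_atTop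
    refine ⟨M, fun n hn => ?_⟩
    by_contra! hd
    rw [dist_eq_norm] at hd
    have h1 := h (hu n) (hu M) hd
    have h2 : f (u n + u M) ≤ ‖f‖ * (2 - η) :=
      (le_abs_self _).trans ((f.le_opNorm _).trans (by gcongr))
    rw [map_add] at h2
    have h3 := hfu n
    have h4 := hfu M
    have h5 := hM n hn
    have h6 := hM M le_rfl
    nlinarith
  obtain ⟨x, hx⟩ := cauchySeq_tendsto_of_complete hcau
  have hx1 : ‖x‖ = 1 := tendsto_nhds_unique hx.norm (by simp [hu])
  refine ⟨x, hx1, le_antisymm ?_ ?_⟩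
  · simpa [hx1] using (le_abs_self _).trans (f.le_opNorm x)
  · refine le_of_tendsto_of_tendsto' ?_ ((f.continuous.tendsto x).comp hx) fun n => (hfu n).le
    simpa using (hlim.const_sub 1).const_mul ‖f‖

/-- If `‖f + g‖` is close to two, some unit vector nearly norms `f` and `g` simultaneously, and
smoothness makes them close. -/
theorem IsUniformlySmooth.uniformConvexSpace_dual (hE : IsUniformlySmooth E) :
    UniformConvexSpace (StrongDual ℝ E) where
  uniform_convex ε hε := by
    obtain ⟨η, hη, h⟩ := hE.exists_norm_sub_le (half_pos hε)
    refine ⟨min η 1, lt_min hη one_pos, fun f hf g hg hfg => ?_⟩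
    by_contra! hlt
    obtain ⟨x, hx, hx'⟩ := exists_unit_lt_apply (by linarith [min_le_right η 1]) hlt
    have := h x f g hx hf.le hg.le (by
      rw [add_apply] at hx'
      linarith [min_le_left η 1])
    linarith

end UniformlyConvex

/-! ### The duality map of the dual as inverse of the duality map. -/

section DualOfPConvex

variable {X : Type*} [NormedAddCommGroup X] [NormedSpace ℝ X] {p p' : ℝ}

theorem norm_inclusionInDoubleDual (x : X) :
    ‖NormedSpace.inclusionInDoubleDual ℝ X x‖ = ‖x‖ :=
  (NormedSpace.inclusionInDoubleDualLi (E := X) ℝ).norm_map x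

theorem inclusionInDoubleDual_mem_dualityMap (hpp' : p.HolderConjugate p') {x : X}
    {ξ : StrongDual ℝ X} (hξ : ξ ∈ dualityMap p x) :
    NormedSpace.inclusionInDoubleDual ℝ X x ∈ dualityMap p' ξ := by
  refine ⟨?_, ?_⟩
  · rw [NormedSpace.dual_def, norm_inclusionInDoubleDual, hξ.1, mul_comm]
  · rw [norm_inclusionInDoubleDual, ← hξ.2, rpow_sub_one_rpow_sub_one hpp' (norm_nonneg x)]

theorem mem_dualityMap_of_inclusionInDoubleDual_mem (hpp' : p.HolderConjugate p') {x : X}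
    {ξ : StrongDual ℝ X} (hx : NormedSpace.inclusionInDoubleDual ℝ X x ∈ dualityMap p' ξ) :
    ξ ∈ dualityMap p x := by
  obtain ⟨h1, h2⟩ := hx
  rw [NormedSpace.dual_def, norm_inclusionInDoubleDual] at h1
  rw [norm_inclusionInDoubleDual] at h2
  exact ⟨by rw [h1, mul_comm],
    by rw [← h2, rpow_sub_one_rpow_sub_one hpp'.symm (norm_nonneg ξ)]⟩

/-- Norm attainment provides a witness, a multiple of a norming unit vector, so the choice in
`dualitySelDual` is not a junk value. -/
theorem inclusionInDoubleDual_dualitySelDual_mem [CompleteSpace X] (hX : IsPConvex p X)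
    (hpp' : p.HolderConjugate p') (ξ : StrongDual ℝ X) :
    NormedSpace.inclusionInDoubleDual ℝ X (dualitySelDual p' ξ) ∈ dualityMap p' ξ := by
  have := hX.uniformConvexSpace
  refine Classical.epsilon_spec
    (p := fun x : X => NormedSpace.inclusionInDoubleDual ℝ X x ∈ dualityMap p' ξ) ?_
  rcases eq_or_ne ξ 0 with rfl | hξ
  · refine ⟨0, ?_⟩
    simp [dualityMap, Real.zero_rpow hpp'.symm.sub_one_ne_zero]
  · obtain ⟨x, hx, hξx⟩ := exists_norm_eq_one_apply_eq_norm hξ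
    have h0 : 0 ≤ ‖ξ‖ ^ (p' - 1) := by positivity
    have hn : ‖‖ξ‖ ^ (p' - 1) • x‖ = ‖ξ‖ ^ (p' - 1) := by
      rw [norm_smul, hx, mul_one, Real.norm_of_nonneg h0]
    refine ⟨‖ξ‖ ^ (p' - 1) • x, ?_, ?_⟩
    · rw [NormedSpace.dual_def, norm_inclusionInDoubleDual, hn, map_smul, hξx, smul_eq_mul,
        mul_comm]
    · rw [norm_inclusionInDoubleDual, hn]

theorem dualitySel_dualitySelDual [CompleteSpace X] (hX : IsPConvex p X)
    (hX' : IsUniformlySmooth X) (hpp' : p.HolderConjugate p') (ξ : StrongDual ℝ X) :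
    dualitySel p (dualitySelDual p' ξ) = ξ :=
  hX'.dualitySel_eq hpp'.lt (mem_dualityMap_of_inclusionInDoubleDual_mem hpp'
    (inclusionInDoubleDual_dualitySelDual_mem hX hpp' ξ))

end DualOfPConvex

/-! ### Consequences of a power bound on the Bregman distance. -/

section PowerSmooth

variable {E : Type*} [NormedAddCommGroup E] [NormedSpace ℝ E] {p p' c : ℝ}

theorem norm_mul_le_of_forall_apply_le (hp : 0 < p) {L : StrongDual ℝ E} {a b t : ℝ} (hb : 0 ≤ b)
    (ht : 0 < t) (h : ∀ x, L x ≤ b * ‖x‖ ^ p + a) : ‖L‖ * t ≤ b * t ^ p + a := by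
  have ha : 0 ≤ a := by simpa [Real.zero_rpow hp.ne'] using h 0
  by_contra! hlt
  rw [← div_lt_iff₀ ht] at hlt
  obtain ⟨x, hx, hx'⟩ := exists_unit_lt_apply (by positivity) hlt
  rw [div_lt_iff₀ ht] at hx'
  have := h (t • x)
  rw [map_smul, smul_eq_mul, norm_smul, hx, mul_one, Real.norm_of_nonneg ht.le, mul_comm] at this
  exact hx'.not_ge this

theorem inv_norm_smul_mem_dualityMap (p : ℝ) {f : StrongDual ℝ E} (hf : f ≠ 0) {x : E}
    (hx : ‖x‖ = 1) (hfx : f x = ‖f‖) : ‖f‖⁻¹ • f ∈ dualityMap p x := by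
  have hn : 0 < ‖f‖ := norm_pos_iff.2 hf
  have h1 : ‖‖f‖⁻¹ • f‖ = 1 := by rw [norm_smul, norm_inv, norm_norm, inv_mul_cancel₀ hn.ne']
  refine ⟨?_, by rw [h1, hx, Real.one_rpow]⟩
  rw [h1, hx, smul_apply, hfx, smul_eq_mul, inv_mul_cancel₀ hn.ne', mul_one]

/-- The value `‖x + v‖ ^ p / p` is bounded below by the subgradient `f` at `u` and above by the
power bound at `x`. -/
theorem sub_dualitySel_apply_le (hpp' : p.HolderConjugate p')
    (h : ∀ x w : E, bregman p x w ≤ c * ‖w - x‖ ^ p) {x u : E} {f : StrongDual ℝ E}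
    (hf : f ∈ dualityMap p u) (v : E) :
    (f - dualitySel p x) v ≤ c * ‖v‖ ^ p + (f - dualitySel p x) (u - x) := by
  have h1 := h x (x + v)
  rw [bregman_eq_sub hpp', add_sub_cancel_left] at h1
  have h2 := subgradient_of_mem_dualityMap hpp' hf (x + v)
  have h3 := subgradient_of_mem_dualityMap hpp' (dualitySel_mem hpp'.lt x) u
  simp only [sub_apply, map_sub, map_add] at h1 h2 h3 ⊢
  linarith

/-- An upper power bound on the Bregman distance makes the duality map single-valued. -/
theorem dualitySel_eq_of_bregman_le (hpp' : p.HolderConjugate p') (hc : 0 ≤ c)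
    (h : ∀ x w : E, bregman p x w ≤ c * ‖w - x‖ ^ p) {x : E} {f : StrongDual ℝ E}
    (hf : f ∈ dualityMap p x) : dualitySel p x = f := by
  have h1 := sub_dualitySel_apply_le hpp' h (x := x) hf
  simp only [sub_self, map_zero] at h1
  have h2 : ∀ t : ℝ, 0 < t → ‖f - dualitySel p x‖ ≤ c * t ^ (p - 1) := fun t ht => by
    have h3 := norm_mul_le_of_forall_apply_le hpp'.pos hc ht h1
    rw [Real.rpow_sub_one ht.ne', mul_div_assoc', le_div_iff₀ ht]
    linarith
  have hlim : Tendsto (fun t : ℝ => c * t ^ (p - 1)) (𝓝[>] 0) (𝓝 0) := by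
    have h3 : ContinuousAt (fun t : ℝ => c * t ^ (p - 1)) 0 :=
      (Real.continuousAt_rpow_const _ _ (Or.inr hpp'.sub_one_pos.le)).const_mul c
    simpa [ContinuousAt, Real.zero_rpow hpp'.sub_one_ne_zero] using h3.tendsto.mono_left
      nhdsWithin_le_nhds
  have h4 : ‖f - dualitySel p x‖ ≤ 0 := ge_of_tendsto hlim (by
    filter_upwards [self_mem_nhdsWithin] with t ht using h2 t ht)
  exact (sub_eq_zero.1 (norm_le_zero_iff.1 h4)).symm

/-- Test on vectors of length `‖u - x‖`: the power bound contributes `c`, and the pairing with `u -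
x` is the symmetrised Bregman distance, contributing `2 * c`. -/
theorem norm_dualitySel_sub_le (hpp' : p.HolderConjugate p') (hc : 0 ≤ c)
    (h : ∀ x w : E, bregman p x w ≤ c * ‖w - x‖ ^ p) (x u : E) :
    ‖dualitySel p u - dualitySel p x‖ ≤ 3 * c * ‖u - x‖ ^ (p - 1) := by
  rcases eq_or_ne u x with rfl | hux
  · rw [sub_self, norm_zero]
    positivity
  have ht : 0 < ‖u - x‖ := norm_pos_iff.2 (sub_ne_zero.2 hux)
  have h1 := norm_mul_le_of_forall_apply_le hpp'.pos hc ht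
    (sub_dualitySel_apply_le hpp' h (x := x) (dualitySel_mem hpp'.lt u))
  have h2 := h x u
  have h3 := h u x
  rw [bregman_eq_sub hpp'] at h2 h3
  rw [norm_sub_rev x u] at h3
  rw [Real.rpow_sub_one ht.ne', mul_div_assoc', le_div_iff₀ ht]
  simp only [sub_apply, map_sub] at h1 h2 h3 ⊢
  linarith

theorem continuous_dualitySel_of_bregman_le (hpp' : p.HolderConjugate p') (hc : 0 ≤ c)
    (h : ∀ x w : E, bregman p x w ≤ c * ‖w - x‖ ^ p) :
    Continuous (dualitySel p : E → StrongDual ℝ E) := by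
  rw [continuous_iff_continuousAt]
  intro x
  rw [ContinuousAt, tendsto_iff_norm_sub_tendsto_zero]
  refine squeeze_zero (fun _ => norm_nonneg _) (norm_dualitySel_sub_le hpp' hc h x) ?_
  have h1 : Continuous fun u : E => 3 * c * ‖u - x‖ ^ (p - 1) :=
    ((continuous_id.sub continuous_const).norm.rpow_const
      fun _ => Or.inr hpp'.sub_one_pos.le).const_mul _
  simpa [Real.zero_rpow hpp'.sub_one_ne_zero] using h1.tendsto x

end PowerSmooth

/-! ### Reflexivity and the descent estimate in the dual. -/

section Reflexive

variable {X : Type*} [NormedAddCommGroup X] [NormedSpace ℝ X] [CompleteSpace X] {p p' c : ℝ}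

theorem dualitySel_eq_inclusionInDoubleDual (hX : IsPConvex p X) (hpp' : p.HolderConjugate p')
    (hc : 0 ≤ c) (h : ∀ ξ η : StrongDual ℝ X, bregman p' ξ η ≤ c * ‖η - ξ‖ ^ p')
    (ξ : StrongDual ℝ X) :
    dualitySel p' ξ = NormedSpace.inclusionInDoubleDual ℝ X (dualitySelDual p' ξ) :=
  dualitySel_eq_of_bregman_le hpp'.symm hc h (inclusionInDoubleDual_dualitySelDual_mem hX hpp' ξ)

theorem continuous_dualitySelDual (hX : IsPConvex p X) (hpp' : p.HolderConjugate p')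
    (hc : 0 ≤ c) (h : ∀ ξ η : StrongDual ℝ X, bregman p' ξ η ≤ c * ‖η - ξ‖ ^ p') :
    Continuous (dualitySelDual p' : StrongDual ℝ X → X) := by
  rw [(NormedSpace.inclusionInDoubleDualLi (E := X) ℝ).isometry.isEmbedding.continuous_iff]
  exact (continuous_dualitySel_of_bregman_le hpp'.symm hc h).congr fun ξ =>
    dualitySel_eq_inclusionInDoubleDual hX hpp' hc h ξ

/-- The dual is uniformly convex, so `Φ` attains its norm at some `ξ`. Then `Φ / ‖Φ‖` is a duality
image of `ξ`; that image is unique and comes from `X`. -/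
theorem surjective_inclusionInDoubleDual (hX : IsPConvex p X) (hX' : IsUniformlySmooth X)
    (hpp' : p.HolderConjugate p') (hc : 0 ≤ c)
    (h : ∀ ξ η : StrongDual ℝ X, bregman p' ξ η ≤ c * ‖η - ξ‖ ^ p') :
    Function.Surjective (NormedSpace.inclusionInDoubleDual ℝ X) := by
  intro Φ
  have := hX'.uniformConvexSpace_dual
  rcases eq_or_ne Φ 0 with rfl | hΦ
  · exact ⟨0, map_zero _⟩
  obtain ⟨ξ, hξ, hΦξ⟩ := exists_norm_eq_one_apply_eq_norm hΦ
  have hn : ‖Φ‖ ≠ 0 := by positivity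
  have hmem := inv_norm_smul_mem_dualityMap p' hΦ hξ hΦξ
  have h2 := dualitySel_eq_of_bregman_le hpp'.symm hc h hmem
  rw [dualitySel_eq_inclusionInDoubleDual hX hpp' hc h] at h2
  exact ⟨‖Φ‖ • dualitySelDual p' ξ, by rw [map_smul, h2, smul_smul, mul_inv_cancel₀ hn, one_smul]⟩

/-- The three-point estimate for a step in the dual space. -/
theorem bregman_dualitySelDual_add_le (hX : IsPConvex p X) (hX' : IsUniformlySmooth X)
    (hpp' : p.HolderConjugate p') (hc : 0 ≤ c)
    (h : ∀ ξ η : StrongDual ℝ X, bregman p' ξ η ≤ c * ‖η - ξ‖ ^ p') (x w : X)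
    (ζ : StrongDual ℝ X) :
    bregman p (dualitySelDual p' (dualitySel p x + ζ)) w ≤
      bregman p x w + ζ (x - w) + c * ‖ζ‖ ^ p' := by
  set η := dualitySel p x + ζ with hη
  -- The change of the Bregman distance is exactly `ζ (x - w)` plus the dual Bregman distance from
  -- `dualitySel p x` to `η`.
  have h1 := h (dualitySel p x) η
  have h2 : dualitySel p' (dualitySel p x) = NormedSpace.inclusionInDoubleDual ℝ X x :=
    dualitySel_eq_of_bregman_le hpp'.symm hc h
      (inclusionInDoubleDual_mem_dualityMap hpp' (dualitySel_mem hpp'.lt x))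
  have h3 : ‖dualitySelDual p' η‖ ^ p = ‖η‖ ^ p' := by
    have := (inclusionInDoubleDual_dualitySelDual_mem hX hpp' η).2
    rw [norm_inclusionInDoubleDual] at this
    rw [← this, rpow_sub_one_rpow hpp'.symm (norm_nonneg η)]
  have h4 : ‖dualitySel p x‖ ^ p' = ‖x‖ ^ p := by
    rw [norm_dualitySel hpp'.lt, rpow_sub_one_rpow hpp' (norm_nonneg x)]
  rw [bregman_eq_sub hpp'.symm, h2, NormedSpace.dual_def, h4] at h1
  rw [bregman_eq hpp', bregman_eq hpp', dualitySel_dualitySelDual hX hX' hpp', h3]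
  have h5 : η - dualitySel p x = ζ := add_sub_cancel_left _ _
  rw [h5] at h1
  rw [hη, add_apply, ← hη, map_sub]
  have h6 : 1 / p' * ‖η‖ ^ p' = ‖η‖ ^ p' / p' := by ring
  have h7 : 1 / p' * ‖x‖ ^ p = ‖x‖ ^ p / p' := by ring
  linarith

end Reflexive

/-- In a reflexive space, a functional which vanishes on the common kernel of finitely many
bounded operators belongs to the norm closure of the sum of the ranges of their adjoints. -/
theorem exists_norm_sub_sum_comp_le {X : Type*} [NormedAddCommGroup X] [NormedSpace ℝ X]
    (hrefl : Function.Surjective (NormedSpace.inclusionInDoubleDual ℝ X))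
    {ι : Type*} [Fintype ι] {Y : ι → Type*} [∀ i, NormedAddCommGroup (Y i)]
    [∀ i, NormedSpace ℝ (Y i)] (A : ∀ i, X →L[ℝ] Y i) {ζ : StrongDual ℝ X}
    (hζ : ∀ x, (∀ i, A i x = 0) → ζ x = 0) {ε : ℝ} (hε : 0 < ε) :
    ∃ η : ∀ i, StrongDual ℝ (Y i), ‖ζ - ∑ i, (η i).comp (A i)‖ ≤ ε := by
  classical
  let T : (∀ i, StrongDual ℝ (Y i)) →ₗ[ℝ] StrongDual ℝ X :=
    { toFun := fun η => ∑ i, (η i).comp (A i)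
      map_add' := fun η θ => by
        simp only [Pi.add_apply, ContinuousLinearMap.add_comp, Finset.sum_add_distrib]
      map_smul' := fun r η => by
        simp only [Pi.smul_apply, ContinuousLinearMap.smul_comp, Finset.smul_sum, RingHom.id_apply] }
  have hmem : ζ ∈ (LinearMap.range T).topologicalClosure := by
    by_contra hnot
    obtain ⟨Φ, u, hΦ, hu⟩ := geometric_hahn_banach_point_closed
      (LinearMap.range T).topologicalClosure.convex
      (LinearMap.range T).isClosed_topologicalClosure hnot
    have hu0 : u < 0 := by simpa using hu 0 (Submodule.zero_mem _)
    have hvan : ∀ b ∈ LinearMap.range T, Φ b = 0 := fun b hb => by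
      by_contra hne
      have := hu (((u - 1) / Φ b) • b)
        ((LinearMap.range T).le_topologicalClosure (Submodule.smul_mem _ _ hb))
      rw [map_smul, smul_eq_mul, div_mul_cancel₀ _ hne] at this
      linarith
    -- By reflexivity the separating functional is a vector. It lies in every kernel, so `ζ`
    -- vanishes on it, contradicting the separation.
    obtain ⟨x, rfl⟩ := hrefl Φ
    have hx : ∀ i, A i x = 0 := fun i => by
      refine SeparatingDual.eq_zero_of_forall_dual_eq_zero (R := ℝ) fun f => ?_
      have := hvan (T (Pi.single i f)) ⟨_, rfl⟩
      rw [NormedSpace.dual_def] at this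
      change (∑ j, ((Pi.single i f : ∀ j, StrongDual ℝ (Y j)) j).comp (A j)) x = 0 at this
      rw [Finset.sum_eq_single i] at this
      · simpa using this
      · intro j _ hj
        simp [Pi.single_eq_of_ne hj]
      · simp
    rw [NormedSpace.dual_def, hζ x hx] at hΦ
    linarith
  obtain ⟨_, ⟨η, rfl⟩, hη⟩ := Metric.mem_closure_iff.1 hmem ε hε
  exact ⟨η, by rw [← dist_eq_norm]; exact hη.le⟩

/-! ### Scalar inequalities and the running-minimum argument. -/

section RealLemmas

theorem mul_rpow_sub_one_self {p a : ℝ} (hp : 1 < p) (ha : 0 ≤ a) : a * a ^ (p - 1) = a ^ p := by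
  simpa [abs_of_nonneg ha] using norm_mul_rpow_sub_one hp a

theorem exists_mul_rpow_sub_one_le {p b κ : ℝ} (hp : 1 < p) (hb : 0 ≤ b) (hκ : 0 < κ) :
    ∃ M : ℝ, 0 ≤ M ∧ ∀ a δ : ℝ, 0 ≤ a → 0 ≤ δ → b * δ * a ^ (p - 1) ≤ κ * a ^ p + M * δ ^ p := by
  refine ⟨b * (b / κ) ^ (p - 1), by positivity, fun a δ ha hδ => ?_⟩
  rw [← mul_rpow_sub_one_self hp ha, ← mul_rpow_sub_one_self hp hδ]
  rcases le_total (b * δ) (κ * a) with h | h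
  · have h1 : b * δ * a ^ (p - 1) ≤ κ * a * a ^ (p - 1) := by gcongr
    have h2 : 0 ≤ b * (b / κ) ^ (p - 1) * (δ * δ ^ (p - 1)) := by positivity
    linarith
  · have h1 : a ≤ b / κ * δ := by
      rw [div_mul_eq_mul_div, le_div_iff₀ hκ]
      linarith
    have h2 : a ^ (p - 1) ≤ (b / κ) ^ (p - 1) * δ ^ (p - 1) := by
      rw [← Real.mul_rpow (by positivity) hδ]
      exact Real.rpow_le_rpow ha h1 (by linarith)
    have h3 : b * δ * a ^ (p - 1) ≤ b * δ * ((b / κ) ^ (p - 1) * δ ^ (p - 1)) := by gcongr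
    have h4 : 0 ≤ κ * (a * a ^ (p - 1)) := by positivity
    linarith

/-- Trades a first power for a `p`-th power at the cost of an arbitrarily small constant. -/
theorem le_add_rpow_mul {p a τ : ℝ} (hp : 1 < p) (ha : 0 ≤ a) (hτ : 0 < τ) :
    a ≤ τ + (τ ^ (p - 1))⁻¹ * a ^ p := by
  rcases le_total a τ with h | h
  · have : 0 ≤ (τ ^ (p - 1))⁻¹ * a ^ p := by positivity
    linarith
  · have h1 : τ ^ (p - 1) ≤ a ^ (p - 1) := Real.rpow_le_rpow hτ.le h (by linarith)
    have h2 : 0 < τ ^ (p - 1) := by positivity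
    have h3 : a ≤ (τ ^ (p - 1))⁻¹ * a ^ p := by
      rw [le_inv_mul_iff₀ h2, ← mul_rpow_sub_one_self hp ha, mul_comm]
      gcongr
    linarith

theorem rpow_sub_one_mul_le {p a b : ℝ} (hp : 1 < p) (ha : 0 ≤ a) (hb : 0 ≤ b) :
    a ^ (p - 1) * b ≤ a ^ p + b ^ p := by
  rw [← mul_rpow_sub_one_self hp ha, ← mul_rpow_sub_one_self hp hb]
  rcases le_total a b with h | h
  · have h1 : a ^ (p - 1) ≤ b ^ (p - 1) := Real.rpow_le_rpow ha h (by linarith)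
    have h2 : a ^ (p - 1) * b ≤ b ^ (p - 1) * b := by gcongr
    have h3 : 0 ≤ a * a ^ (p - 1) := by positivity
    linarith
  · have h2 : a ^ (p - 1) * b ≤ a ^ (p - 1) * a := by gcongr
    have h3 : 0 ≤ b * b ^ (p - 1) := by positivity
    linarith

/-- A nonincreasing nonnegative sequence `d` whose decrements dominate `μ e`, with `μ` not summable,
and which is controlled by its own decrements at the running minima of `e`, tends to zero. -/
theorem tendsto_zero_of_le_at_running_minima {d e μ : ℕ → ℝ} {κ A : ℝ} (hκ : 0 < κ)
    (hA : 0 ≤ A) (hd : ∀ n, 0 ≤ d n) (he : ∀ n, 0 ≤ e n) (hμ : ∀ n, 1 ≤ n → 0 < μ n)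
    (hμsum : Tendsto (fun n : ℕ => ∑ l ∈ Finset.Icc 1 n, μ l) atTop atTop)
    (hstep : ∀ n, κ * (μ (n + 1) * e n) ≤ d n - d (n + 1))
    (hmin : ∀ l, ∀ ε > 0, ∃ Q : ℝ, 0 ≤ Q ∧ ∀ k, l ≤ k → (∀ m, l ≤ m → m < k → e k ≤ e m) →
      d k ≤ ε + Q * e k + A * (d l - d k)) :
    Tendsto d atTop (𝓝 0) := by
  have hanti : Antitone d := antitone_nat_of_succ_le fun n => by
    have := hstep n
    have h2 : 0 ≤ κ * (μ (n + 1) * e n) :=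
      mul_nonneg hκ.le (mul_nonneg (hμ _ (by omega)).le (he n))
    linarith
  have hsmall : ∀ l, ∀ ε > 0, ∃ k, l ≤ k ∧ e k < ε := by
    intro l ε hε
    by_contra! h
    have htel : ∀ n, κ * ε * (∑ j ∈ Finset.Icc 1 (l + n), μ j - ∑ j ∈ Finset.Icc 1 l, μ j)
        ≤ d l - d (l + n) := by
      intro n
      induction n with
      | zero => simp
      | succ n ih =>
        have h1 := hstep (l + n)
        have h2 := h (l + n) (by omega)
        have h3 : κ * ε * μ (l + n + 1) ≤ κ * (μ (l + n + 1) * e (l + n)) := by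
          have := hμ (l + n + 1) (by omega)
          rw [mul_assoc, mul_comm ε]
          gcongr
        rw [← add_assoc, Finset.sum_Icc_succ_top (by omega)]
        linarith
    obtain ⟨n, hn1, hn2⟩ := ((hμsum.eventually_gt_atTop
      (∑ j ∈ Finset.Icc 1 l, μ j + d l / (κ * ε))).and (eventually_ge_atTop l)).exists
    have h1 := htel (n - l)
    rw [Nat.add_sub_cancel' hn2] at h1
    have h2 : d l / (κ * ε) < ∑ j ∈ Finset.Icc 1 n, μ j - ∑ j ∈ Finset.Icc 1 l, μ j := by linarith
    rw [div_lt_iff₀ (by positivity)] at h2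
    linarith [hd n]
  have hbdd : BddBelow (Set.range d) := ⟨0, by rintro _ ⟨n, rfl⟩; exact hd n⟩
  have hlim := tendsto_atTop_ciInf hanti hbdd
  set D := ⨅ n, d n with hD
  have hDle : ∀ n, D ≤ d n := fun n => ciInf_le hbdd n
  have hkey : ∀ l, D ≤ A * (d l - D) := by
    intro l
    refine le_of_forall_pos_le_add fun ε hε => ?_
    obtain ⟨Q, hQ, hQk⟩ := hmin l (ε / 2) (half_pos hε)
    have hε' : 0 < ε / 2 / (Q + 1) := by positivity
    classical
    -- The first index from `l` on with `e` below the threshold is a running minimum, and the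
    -- threshold makes `Q * e k` at most `ε / 2`.
    have hex := hsmall l _ hε'
    obtain ⟨hk1, hk2⟩ := Nat.find_spec hex
    set k := Nat.find hex
    have h1 := hQk k hk1 fun m hm hmk => by
      have := Nat.find_min hex hmk
      simp only [not_and, not_lt] at this
      exact hk2.le.trans (this hm)
    rw [lt_div_iff₀ (by positivity)] at hk2
    have h2 : A * (d l - d k) ≤ A * (d l - D) := by
      have := hDle k
      gcongr
    have h3 := hDle k
    have h4 := he k
    nlinarith
  have h0 : D ≤ 0 := by
    refine ge_of_tendsto' (f := fun l => A * (d l - D)) (x := atTop) ?_ hkey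
    simpa using (hlim.sub_const D).const_mul A
  have h0' : 0 ≤ D := le_ciInf hd
  rwa [le_antisymm h0 h0'] at hlim

end RealLemmas

/-! ### Residuals, standing assumptions and the single-step estimate. -/

section Residual

variable {X : Type*} {N : ℕ} {Y : Fin N → Type*} [∀ i, NormedAddCommGroup (Y i)]

/-- The sum of the `p`-th powers of the residuals of all equations. -/
noncomputable def residual (p : ℝ) (F : ∀ i, X → Y i) (y : ∀ i, Y i) (x : X) : ℝ :=
  ∑ i, ‖F i x - y i‖ ^ p

theorem residual_nonneg (p : ℝ) (F : ∀ i, X → Y i) (y : ∀ i, Y i) (x : X) :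
    0 ≤ residual p F y x :=
  Finset.sum_nonneg fun _ _ => by positivity

theorem rpow_le_residual (p : ℝ) (F : ∀ i, X → Y i) (y : ∀ i, Y i) (x : X) (i : Fin N) :
    ‖F i x - y i‖ ^ p ≤ residual p F y x :=
  Finset.single_le_sum (f := fun i => ‖F i x - y i‖ ^ p) (fun _ _ => by positivity)
    (Finset.mem_univ i)

end Residual

section Iteration

variable {X : Type*} [NormedAddCommGroup X] [NormedSpace ℝ X]
  {N : ℕ} {Y : Fin N → Type*} [∀ i, NormedAddCommGroup (Y i)] [∀ i, NormedSpace ℝ (Y i)]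

/-- The standing assumptions on the spaces, the operators and the reference solution. -/
structure SGDSetting (p p' c γ Λ ν : ℝ) (F : ∀ i, X → Y i) (F' : ∀ i, X → X →L[ℝ] Y i)
    (y : ∀ i, Y i) (S : Set X) (x₀ xs : X) : Prop where
  conj : p.HolderConjugate p'
  convex : IsPConvex p X
  smooth : IsUniformlySmooth X
  smooth_codomain : ∀ i, IsUniformlySmooth (Y i)
  c_nonneg : 0 ≤ c
  bregman_dual_le : ∀ ξ η : StrongDual ℝ X, bregman p' ξ η ≤ c * ‖η - ξ‖ ^ p'
  isSolution : IsMinDistSolution p S F y x₀ xs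
  γ_nonneg : 0 ≤ γ
  γ_lt_one : γ < 1
  bregman_lt : bregman p x₀ xs < ν
  ball_subset : bregmanBall p ν xs ⊆ S
  continuousOn : ∀ i, ContinuousOn (F i) S
  continuousOn_deriv : ∀ i, ContinuousOn (F' i) S
  norm_deriv_le : ∀ i, ∀ x ∈ S, ‖F' i x‖ ≤ Λ
  cone : ∀ i, ∀ x ∈ S, ∀ x' ∈ S, ‖F i x - F i x' - F' i x (x - x')‖ ≤ γ * ‖F i x - F i x'‖
  null : ∀ x ∈ S, ∀ h : X, (∀ i, F' i xs h = 0) → ∀ i, F' i x h = 0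

theorem sgdIterate_congr (p : ℝ) (F : ∀ i, X → Y i) (F' : ∀ i, X → X →L[ℝ] Y i) (y : ∀ i, Y i)
    (μ : ℕ → ℝ) (x₀ : X) {i i' : ℕ → Fin N} {n : ℕ} (h : ∀ m ∈ Set.Icc 1 n, i m = i' m) :
    sgdIterate p F F' y μ x₀ i n = sgdIterate p F F' y μ x₀ i' n := by
  induction n with
  | zero => rfl
  | succ n ih =>
    rw [sgdIterate, sgdIterate, ih fun m hm => h m ⟨hm.1, hm.2.trans n.le_succ⟩,
      h (n + 1) ⟨by omega, le_rfl⟩]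

variable {p p' c γ Λ ν : ℝ} {F : ∀ i, X → Y i} {F' : ∀ i, X → X →L[ℝ] Y i}
  {y : ∀ i, Y i} {S : Set X} {x₀ xs : X}

namespace SGDSetting

theorem norm_deriv_apply_le (H : SGDSetting p p' c γ Λ ν F F' y S x₀ xs) {x x' : X}
    (hx : x ∈ S) (hx' : x' ∈ S) (i : Fin N) :
    ‖F' i x (x - x')‖ ≤ (1 + γ) * ‖F i x - F i x'‖ := by
  have h1 := H.cone i x hx x' hx'
  have h2 := norm_sub_norm_le (F' i x (x - x')) (F i x - F i x')
  rw [norm_sub_rev (F' i x (x - x'))] at h2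
  linarith

/-- One step of the iteration decreases the Bregman distance to the solution up to noise. -/
theorem exists_bregman_step_le (H : SGDSetting p p' c γ Λ ν F F' y S x₀ xs) [CompleteSpace X]
    {C : ℝ} (hC : 0 < C) :
    ∃ M : ℝ, 0 ≤ M ∧ ∀ (yδ : ∀ i, Y i) (δ m : ℝ) (x : X) (i : Fin N), 0 ≤ δ →
      ‖y i - yδ i‖ ≤ δ → 0 < m → C ≤ 1 - γ - Λ ^ p' * c * m ^ (p' - 1) → x ∈ S →
      bregman p (dualitySelDual p' (dualitySel p x - m • sgdGradient p F F' yδ x i)) xs ≤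
        bregman p x xs - C / 2 * (m * ‖F i x - yδ i‖ ^ p) + M * (m * δ ^ p) := by
  have hpp' := H.conj
  have hp := hpp'.lt
  have hγ := H.γ_nonneg
  -- Half of `C` absorbs the cross term between noise and residual; the other half remains as
  -- decrease.
  obtain ⟨M, hM, hyoung⟩ := exists_mul_rpow_sub_one_le (b := 1 + γ) hp (by linarith) (half_pos hC)
  refine ⟨M, hM, fun yδ δ m x i hδ hyδ hm hmC hx => ?_⟩
  set r := F i x - yδ i with hr
  set A := F' i x
  set g : StrongDual ℝ X := sgdGradient p F F' yδ x i
  have hxs := H.isSolution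
  have h1 := bregman_dualitySelDual_add_le H.convex H.smooth hpp' H.c_nonneg H.bregman_dual_le
    x xs (-(m • g))
  rw [← sub_eq_add_neg] at h1
  have hΛ : 0 ≤ Λ := (norm_nonneg _).trans (H.norm_deriv_le i x hx)
  have hjr : dualitySel p r r = ‖r‖ ^ p := apply_self_of_mem_dualityMap hp (dualitySel_mem hp r)
  have hrr := norm_mul_rpow_sub_one hp r
  have hgn : ‖g‖ ≤ ‖r‖ ^ (p - 1) * Λ := by
    rw [← norm_dualitySel hp r]
    exact (ContinuousLinearMap.opNorm_comp_le _ _).trans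
      (mul_le_mul_of_nonneg_left (H.norm_deriv_le i x hx) (norm_nonneg _))
  have hquad : c * ‖-(m • g)‖ ^ p' ≤ Λ ^ p' * c * m ^ (p' - 1) * (m * ‖r‖ ^ p) := by
    have h2 : ‖-(m • g)‖ ≤ m * (‖r‖ ^ (p - 1) * Λ) := by
      rw [norm_neg, norm_smul, Real.norm_of_nonneg hm.le]
      gcongr
    have h3 : ‖-(m • g)‖ ^ p' ≤ m ^ p' * (‖r‖ ^ p * Λ ^ p') := by
      rw [← rpow_sub_one_rpow hpp' (norm_nonneg r), ← Real.mul_rpow (by positivity) hΛ,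
        ← Real.mul_rpow hm.le (by positivity)]
      exact Real.rpow_le_rpow (norm_nonneg _) h2 hpp'.symm.pos.le
    have h4 := mul_le_mul_of_nonneg_left h3 H.c_nonneg
    rw [← mul_rpow_sub_one_self hpp'.symm.lt hm.le] at h4
    linarith
  have hres : ‖r - A (x - xs)‖ ≤ γ * ‖r‖ + (1 + γ) * δ := by
    have h2 := H.cone i x hx xs hxs.1
    rw [hxs.2.1 i] at h2
    have h3 : r - A (x - xs) = (F i x - y i - A (x - xs)) + (y i - yδ i) := by rw [hr]; abel
    have h4 : F i x - y i = r - (y i - yδ i) := by rw [hr]; abel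
    have h5 : ‖F i x - y i‖ ≤ ‖r‖ + δ := by
      rw [h4]; exact (norm_sub_le _ _).trans (by gcongr)
    rw [h3]
    have h6 := norm_add_le (F i x - y i - A (x - xs)) (y i - yδ i)
    have h7 := mul_le_mul_of_nonneg_left h5 hγ
    linarith
  have hlin : (-(m • g)) (x - xs) ≤
      m * (-(1 - γ) * ‖r‖ ^ p + (1 + γ) * δ * ‖r‖ ^ (p - 1)) := by
    have h2 : g (x - xs) = dualitySel p r r - dualitySel p r (r - A (x - xs)) := by
      rw [← map_sub (dualitySel p r), sub_sub_cancel]; rfl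
    have h3 : dualitySel p r (r - A (x - xs)) ≤ ‖r‖ ^ (p - 1) * (γ * ‖r‖ + (1 + γ) * δ) := by
      rw [← norm_dualitySel hp r]
      exact (le_abs_self _).trans (((dualitySel p r).le_opNorm _).trans (by gcongr))
    rw [neg_apply, smul_apply, smul_eq_mul, ← mul_neg, h2, hjr]
    refine mul_le_mul_of_nonneg_left ?_ hm.le
    have h4 : ‖r‖ ^ (p - 1) * (γ * ‖r‖ + (1 + γ) * δ) =
        γ * ‖r‖ ^ p + (1 + γ) * δ * ‖r‖ ^ (p - 1) := by rw [← hrr]; ring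
    linarith
  have hy := mul_le_mul_of_nonneg_left (hyoung ‖r‖ δ (norm_nonneg r) hδ) hm.le
  have hcc := mul_le_mul_of_nonneg_right hmC (by positivity : 0 ≤ m * ‖r‖ ^ p)
  linarith

variable {C M δ : ℝ} {μ : ℕ → ℝ} {yδ : ∀ i, Y i}

theorem sgdIterate_succ (H : SGDSetting p p' c γ Λ ν F F' y S x₀ xs) (yδ : ∀ i, Y i)
    (μ : ℕ → ℝ) (i : ℕ → Fin N) (n : ℕ) :
    sgdIterate p F F' yδ μ x₀ i (n + 1) = dualitySelDual p'
      (dualitySel p (sgdIterate p F F' yδ μ x₀ i n) -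
        μ (n + 1) • sgdGradient p F F' yδ (sgdIterate p F F' yδ μ x₀ i n) (i (n + 1))) := by
  rw [sgdIterate, H.conj.conjExponent_eq]

theorem dualitySel_sgdIterate_succ (H : SGDSetting p p' c γ Λ ν F F' y S x₀ xs)
    [CompleteSpace X] (yδ : ∀ i, Y i) (μ : ℕ → ℝ) (i : ℕ → Fin N) (n : ℕ) :
    dualitySel p (sgdIterate p F F' yδ μ x₀ i (n + 1)) =
      dualitySel p (sgdIterate p F F' yδ μ x₀ i n) -
        μ (n + 1) • sgdGradient p F F' yδ (sgdIterate p F F' yδ μ x₀ i n) (i (n + 1)) := by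
  rw [H.sgdIterate_succ, dualitySel_dualitySelDual H.convex H.smooth H.conj]

/-- The reference solution is an interior point of `S`. -/
theorem mem_nhds (H : SGDSetting p p' c γ Λ ν F F' y S x₀ xs) : S ∈ 𝓝 xs := by
  refine mem_of_superset ?_ H.ball_subset
  have h1 : Tendsto (fun z : X => bregman p z xs) (𝓝 xs) (𝓝 (bregman p xs xs)) :=
    (H.smooth.continuous_bregman_left H.conj xs).tendsto xs
  rw [bregman_self H.conj] at h1
  exact (h1.eventually (gt_mem_nhds ((bregman_nonneg H.conj x₀ xs).trans_lt H.bregman_lt))).mono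
    fun z hz => le_of_lt hz

theorem x₀_mem (H : SGDSetting p p' c γ Λ ν F F' y S x₀ xs) : x₀ ∈ S :=
  H.ball_subset H.bregman_lt.le

/-- First-order optimality of the minimum-distance solution. -/
theorem dualitySel_sub_apply_eq_zero (H : SGDSetting p p' c γ Λ ν F F' y S x₀ xs) {h : X}
    (hh : ∀ i, F' i xs h = 0) : (dualitySel p xs - dualitySel p x₀) h = 0 := by
  have hpp' := H.conj
  have key : ∀ v : X, (∀ i, F' i xs v = 0) → dualitySel p x₀ v ≤ dualitySel p xs v := by
    intro v hv
    have hline : Continuous fun t : ℝ => xs + t • v := by fun_prop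
    have hline0 : Tendsto (fun t : ℝ => xs + t • v) (𝓝[>] 0) (𝓝 xs) := by
      simpa using (hline.tendsto 0).mono_left nhdsWithin_le_nhds
    have hlim : Tendsto (fun t : ℝ => dualitySel p (xs + t • v) v) (𝓝[>] 0)
        (𝓝 (dualitySel p xs v)) := by
      have h1 : Continuous fun u : X => dualitySel p u v :=
        (H.smooth.continuous_dualitySel hpp'.lt).clm_apply continuous_const
      exact (h1.tendsto xs).comp hline0
    refine ge_of_tendsto hlim ?_
    filter_upwards [hline0.eventually H.mem_nhds, self_mem_nhdsWithin] with t htS ht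
    have ht : 0 < t := ht
    -- Since `v` is in the kernel, the cone condition bounds the change of `F i` by `γ < 1` times
    -- itself. Hence `xs + t • v` is a competing solution.
    have hsol : ∀ i, F i (xs + t • v) = y i := fun i => by
      have h1 := H.cone i xs H.isSolution.1 _ htS
      have h2 : F' i xs (xs - (xs + t • v)) = 0 := by
        rw [sub_add_cancel_left, map_neg, map_smul, hv i, smul_zero, neg_zero]
      rw [h2, sub_zero, H.isSolution.2.1 i] at h1
      have h3 : ‖y i - F i (xs + t • v)‖ ≤ 0 := by
        nlinarith [H.γ_lt_one, norm_nonneg (y i - F i (xs + t • v))]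
      exact (sub_eq_zero.1 (norm_le_zero_iff.1 h3)).symm
    have h1 := H.isSolution.2.2 _ htS hsol
    have h2 := subgradient_of_mem_dualityMap hpp' (dualitySel_mem hpp'.lt (xs + t • v)) xs
    rw [bregman_eq_sub hpp', bregman_eq_sub hpp'] at h1
    have h3 : xs + t • v - x₀ = (xs - x₀) + t • v := by abel
    rw [h3, map_add, map_smul, smul_eq_mul] at h1
    rw [sub_add_cancel_left, map_neg, map_smul, smul_eq_mul] at h2
    exact le_of_mul_le_mul_left (by linarith) ht
  have h1 := key h hh
  have h2 := key (-h) fun i => by rw [map_neg, hh i, neg_zero]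
  rw [map_neg, map_neg] at h2
  rw [sub_apply]
  linarith

/-- As long as the iterates stay in `S`, their dual increments annihilate the null space. -/
theorem dualitySel_sgdIterate_sub_apply_eq_zero (H : SGDSetting p p' c γ Λ ν F F' y S x₀ xs)
    [CompleteSpace X] (yδ : ∀ i, Y i) (μ : ℕ → ℝ) (i : ℕ → Fin N) (n : ℕ)
    (hS : ∀ m < n, sgdIterate p F F' yδ μ x₀ i m ∈ S) {h : X} (hh : ∀ j, F' j xs h = 0) :
    (dualitySel p (sgdIterate p F F' yδ μ x₀ i n) - dualitySel p xs) h = 0 := by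
  induction n with
  | zero =>
    have := H.dualitySel_sub_apply_eq_zero hh
    rw [sub_apply] at this ⊢
    simp only [sgdIterate]
    linarith
  | succ n ih =>
    have h1 := ih fun m hm => hS m (by omega)
    have h2 : sgdGradient p F F' yδ (sgdIterate p F F' yδ μ x₀ i n) (i (n + 1)) h = 0 := by
      rw [sgdGradient, ContinuousLinearMap.comp_apply, H.null _ (hS n (by omega)) h hh, map_zero]
    rw [sub_apply] at h1 ⊢
    rw [H.dualitySel_sgdIterate_succ, sub_apply, smul_apply, h2, smul_zero, sub_zero, h1]

/-- A functional annihilating the null space is, at `x - xs`, controlled by the residual. -/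
theorem exists_apply_sub_le (H : SGDSetting p p' c γ Λ ν F F' y S x₀ xs) [CompleteSpace X]
    {ζ : StrongDual ℝ X} (hζ : ∀ h, (∀ i, F' i xs h = 0) → ζ h = 0) (B : ℝ) {ε : ℝ}
    (hε : 0 < ε) :
    ∃ Q : ℝ, 0 ≤ Q ∧ ∀ x ∈ S, ‖x - xs‖ ≤ B → ζ (x - xs) ≤ ε + Q * residual p F y x := by
  have hγ := H.γ_nonneg
  obtain ⟨η, hη⟩ := exists_norm_sub_sum_comp_le (surjective_inclusionInDoubleDual H.convex
    H.smooth H.conj H.c_nonneg H.bregman_dual_le) (fun i => F' i xs) hζ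
    (show 0 < ε / (2 * (|B| + 1)) by positivity)
  set W := ∑ i, ‖η i‖ * (1 + γ) with hW
  have hW0 : 0 ≤ W := Finset.sum_nonneg fun i _ => by positivity
  -- One half of `ε` pays for approximating `ζ` by adjoint images, the other for `W * τ`.
  set τ := ε / (2 * (W + 1)) with hτ
  have hτ0 : 0 < τ := by positivity
  refine ⟨W * (τ ^ (p - 1))⁻¹, by positivity, fun x hx hxB => ?_⟩
  have h1 : (ζ - ∑ i, (η i).comp (F' i xs)) (x - xs) ≤ ε / 2 := by
    refine (le_abs_self _).trans ((ContinuousLinearMap.le_opNorm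
      (ζ - ∑ i, (η i).comp (F' i xs)) (x - xs)).trans ?_)
    refine (mul_le_mul hη (hxB.trans (le_abs_self B)) (norm_nonneg _) (by positivity)).trans ?_
    rw [div_mul_eq_mul_div, div_le_div_iff₀ (by positivity) two_pos]
    nlinarith [abs_nonneg B]
  have h2 : (∑ i, (η i).comp (F' i xs)) (x - xs) ≤
      W * (τ + (τ ^ (p - 1))⁻¹ * residual p F y x) := by
    rw [sum_apply, hW, Finset.sum_mul]
    refine Finset.sum_le_sum fun i _ => ?_
    have h3 : ‖F' i xs (x - xs)‖ ≤ (1 + γ) * ‖F i x - y i‖ := by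
      have := H.norm_deriv_apply_le H.isSolution.1 hx i
      rwa [← neg_sub, map_neg, norm_neg, ← norm_neg (F i xs - F i x), neg_sub,
        H.isSolution.2.1 i] at this
    have h4 : ‖F i x - y i‖ ≤ τ + (τ ^ (p - 1))⁻¹ * residual p F y x :=
      (le_add_rpow_mul H.conj.lt (norm_nonneg _) hτ0).trans (by
        have := rpow_le_residual p F y x i
        gcongr)
    calc η i (F' i xs (x - xs)) ≤ ‖η i‖ * ‖F' i xs (x - xs)‖ :=
          (le_abs_self _).trans ((η i).le_opNorm _)
      _ ≤ ‖η i‖ * ((1 + γ) * (τ + (τ ^ (p - 1))⁻¹ * residual p F y x)) := by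
          gcongr
          exact h3.trans (by gcongr)
      _ = _ := by ring
  have h3 : W * τ ≤ ε / 2 := by
    rw [hτ, mul_div_assoc', div_le_div_iff₀ (by positivity) two_pos]
    nlinarith
  rw [sub_apply] at h1
  linarith

end SGDSetting

end Iteration

/-! ### Estimates along a fixed index sequence. -/

section Paths

variable {X : Type*} [NormedAddCommGroup X] [NormedSpace ℝ X]
  {N : ℕ} {Y : Fin N → Type*} [∀ i, NormedAddCommGroup (Y i)] [∀ i, NormedSpace ℝ (Y i)]
  {p p' c γ Λ ν C : ℝ} {F : ∀ i, X → Y i} {F' : ∀ i, X → X →L[ℝ] Y i}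
  {y : ∀ i, Y i} {S : Set X} {x₀ xs : X} {μ : ℕ → ℝ}

namespace SGDSetting

/-- Along every index sequence, the iterates stay in `S` and the Bregman distance to the solution
decreases up to noise, as long as the accumulated noise is small. -/
theorem exists_bregman_sgdIterate_le (H : SGDSetting p p' c γ Λ ν F F' y S x₀ xs)
    [CompleteSpace X] (hC : 0 < C) (hμ : ∀ l, 1 ≤ l → 0 < μ l)
    (hμC : ∀ l, 1 ≤ l → C ≤ 1 - γ - Λ ^ p' * c * μ l ^ (p' - 1)) :
    ∃ M : ℝ, 0 ≤ M ∧ ∀ (yδ : ∀ i, Y i) (δ : ℝ) (i : ℕ → Fin N) (n : ℕ), 0 ≤ δ →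
      (∀ j, ‖y j - yδ j‖ ≤ δ) →
      bregman p x₀ xs + M * (δ ^ p * ∑ l ∈ Finset.Icc 1 n, μ l) ≤ ν →
      (∀ k ≤ n, sgdIterate p F F' yδ μ x₀ i k ∈ S) ∧
      ∀ k < n, bregman p (sgdIterate p F F' yδ μ x₀ i (k + 1)) xs ≤
        bregman p (sgdIterate p F F' yδ μ x₀ i k) xs -
          C / 2 * (μ (k + 1) * ‖F (i (k + 1)) (sgdIterate p F F' yδ μ x₀ i k) -
            yδ (i (k + 1))‖ ^ p) + M * (μ (k + 1) * δ ^ p) := by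
  obtain ⟨M, hM, hstep⟩ := H.exists_bregman_step_le hC
  refine ⟨M, hM, fun yδ δ i n hδ hyδ hn => ?_⟩
  have hst : ∀ k, sgdIterate p F F' yδ μ x₀ i k ∈ S →
      bregman p (sgdIterate p F F' yδ μ x₀ i (k + 1)) xs ≤
        bregman p (sgdIterate p F F' yδ μ x₀ i k) xs -
          C / 2 * (μ (k + 1) * ‖F (i (k + 1)) (sgdIterate p F F' yδ μ x₀ i k) -
            yδ (i (k + 1))‖ ^ p) + M * (μ (k + 1) * δ ^ p) := fun k hk => by
    rw [H.sgdIterate_succ]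
    exact hstep yδ δ _ _ _ hδ (hyδ _) (hμ _ (by omega)) (hμC _ (by omega)) hk
  have hδp : 0 ≤ δ ^ p := by positivity
  -- Both claims need a joint induction: a step estimate requires membership in `S`, and the
  -- resulting bound puts the next iterate in the Bregman ball.
  have hmem : ∀ k ≤ n, sgdIterate p F F' yδ μ x₀ i k ∈ S ∧
      bregman p (sgdIterate p F F' yδ μ x₀ i k) xs ≤
        bregman p x₀ xs + M * (δ ^ p * ∑ l ∈ Finset.Icc 1 k, μ l) := by
    intro k hk
    induction k with
    | zero => exact ⟨H.x₀_mem, by simp [sgdIterate]⟩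
    | succ k ih =>
      obtain ⟨h1, h2⟩ := ih (by omega)
      have h3 := hst k h1
      have h4 : 0 ≤ C / 2 * (μ (k + 1) * ‖F (i (k + 1)) (sgdIterate p F F' yδ μ x₀ i k) -
            yδ (i (k + 1))‖ ^ p) := by
        have := hμ (k + 1) (by omega)
        positivity
      have h5 : bregman p (sgdIterate p F F' yδ μ x₀ i (k + 1)) xs ≤
          bregman p x₀ xs + M * (δ ^ p * ∑ l ∈ Finset.Icc 1 (k + 1), μ l) := by
        rw [Finset.sum_Icc_succ_top (by omega)]
        linarith
      refine ⟨H.ball_subset (h5.trans (le_trans ?_ hn)), h5⟩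
      have : ∑ l ∈ Finset.Icc 1 (k + 1), μ l ≤ ∑ l ∈ Finset.Icc 1 n, μ l :=
        Finset.sum_le_sum_of_subset_of_nonneg (Finset.Icc_subset_Icc le_rfl hk)
          fun l hl _ => (hμ l (Finset.mem_Icc.1 hl).1).le
      gcongr
  exact ⟨fun k hk => (hmem k hk).1, fun k hk => hst k (hmem k hk.le).1⟩

theorem dualitySel_sgdIterate_sub (H : SGDSetting p p' c γ Λ ν F F' y S x₀ xs) [CompleteSpace X]
    (yδ : ∀ i, Y i) (μ : ℕ → ℝ) (i : ℕ → Fin N) {l k : ℕ} (hlk : l ≤ k) (v : X) :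
    (dualitySel p (sgdIterate p F F' yδ μ x₀ i k) -
      dualitySel p (sgdIterate p F F' yδ μ x₀ i l)) v =
      ∑ m ∈ Finset.Ico l k, μ (m + 1) *
        -sgdGradient p F F' yδ (sgdIterate p F F' yδ μ x₀ i m) (i (m + 1)) v := by
  induction k, hlk using Nat.le_induction with
  | base => simp
  | succ k hk ih =>
    rw [Finset.sum_Ico_succ_top hk, ← ih, H.dualitySel_sgdIterate_succ]
    simp only [sub_apply, smul_apply, smul_eq_mul]
    ring

/-- Writing `x_k - xs = (x_m - xs) - (x_m - x_k)`, the cone condition at `x_m` leaves only residuals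
at `x_m` and `x_k`. The full residual appears at `x_k` because the earlier index `i (m + 1)` is not
independent of `x_k`. -/
theorem dualitySel_sgdIterate_sub_apply_le (H : SGDSetting p p' c γ Λ ν F F' y S x₀ xs)
    [CompleteSpace X] (hμ : ∀ l, 1 ≤ l → 0 < μ l) (i : ℕ → Fin N)
    (hS : ∀ k, sgdIterate p F F' y μ x₀ i k ∈ S) {l k : ℕ} (hlk : l ≤ k) :
    (dualitySel p (sgdIterate p F F' y μ x₀ i k) -
      dualitySel p (sgdIterate p F F' y μ x₀ i l)) (sgdIterate p F F' y μ x₀ i k - xs) ≤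
      ∑ m ∈ Finset.Ico l k, μ (m + 1) * ((1 + γ) *
        (3 * ‖F (i (m + 1)) (sgdIterate p F F' y μ x₀ i m) - y (i (m + 1))‖ ^ p +
          residual p F y (sgdIterate p F F' y μ x₀ i k))) := by
  rw [H.dualitySel_sgdIterate_sub y μ i hlk]
  refine Finset.sum_le_sum fun m _ => mul_le_mul_of_nonneg_left ?_ (hμ _ (by omega)).le
  set u := sgdIterate p F F' y μ x₀ i k
  set x := sgdIterate p F F' y μ x₀ i m
  set j := i (m + 1)
  have hγ := H.γ_nonneg
  have hp := H.conj.lt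
  set r := F j x - y j with hr
  have h1 : -sgdGradient p F F' y x j (u - xs) ≤ ‖r‖ ^ (p - 1) * ‖F' j x (u - xs)‖ := by
    rw [← norm_dualitySel hp r]
    exact (neg_le_abs _).trans ((dualitySel p r).le_opNorm _)
  have h2 : ‖F' j x (u - xs)‖ ≤ (1 + γ) * (2 * ‖r‖ + ‖F j u - y j‖) := by
    have h3 := H.norm_deriv_apply_le (hS m) H.isSolution.1 j
    have h4 := H.norm_deriv_apply_le (hS m) (hS k) j
    rw [H.isSolution.2.1 j] at h3
    have h5 : u - xs = (x - xs) - (x - u) := by abel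
    have h6 : F j x - F j u = r - (F j u - y j) := by rw [hr]; abel
    have h7 : ‖F j x - F j u‖ ≤ ‖r‖ + ‖F j u - y j‖ := h6 ▸ norm_sub_le _ _
    rw [h5, map_sub]
    refine (norm_sub_le _ _).trans ((add_le_add h3 h4).trans ?_)
    have := mul_le_mul_of_nonneg_left h7 (by linarith : 0 ≤ 1 + γ)
    linarith
  have h3 := rpow_sub_one_mul_le hp (norm_nonneg r) (norm_nonneg (F j u - y j))
  have h4 := rpow_le_residual p F y u j
  have h5 := norm_mul_rpow_sub_one hp r
  calc _ ≤ ‖r‖ ^ (p - 1) * ((1 + γ) * (2 * ‖r‖ + ‖F j u - y j‖)) := h1.trans (by gcongr)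
    _ = (1 + γ) * (2 * (‖r‖ * ‖r‖ ^ (p - 1)) + ‖r‖ ^ (p - 1) * ‖F j u - y j‖) := by ring
    _ ≤ _ := by
      rw [h5]
      exact mul_le_mul_of_nonneg_left (by linarith) (by linarith)

/-- For a fixed number of steps, the iterates depend continuously on the data. -/
theorem tendsto_sgdIterate (H : SGDSetting p p' c γ Λ ν F F' y S x₀ xs) [CompleteSpace X]
    {ι : Type*} {lf : Filter ι} {yδ : ι → ∀ i, Y i}
    (hy : ∀ j, Tendsto (fun t => yδ t j) lf (𝓝 (y j))) (i : ℕ → Fin N) {n : ℕ}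
    (hS : ∀ k ≤ n, sgdIterate p F F' y μ x₀ i k ∈ S)
    (hSδ : ∀ k ≤ n, ∀ᶠ t in lf, sgdIterate p F F' (yδ t) μ x₀ i k ∈ S) :
    Tendsto (fun t => sgdIterate p F F' (yδ t) μ x₀ i n) lf
      (𝓝 (sgdIterate p F F' y μ x₀ i n)) := by
  induction n with
  | zero => exact tendsto_const_nhds
  | succ n ih =>
    have hlim := ih (fun k hk => hS k (by omega)) fun k hk => hSδ k (by omega)
    have hin : Tendsto (fun t => sgdIterate p F F' (yδ t) μ x₀ i n) lf
        (𝓝[S] (sgdIterate p F F' y μ x₀ i n)) :=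
      tendsto_nhdsWithin_iff.2 ⟨hlim, hSδ n (by omega)⟩
    have hmem := hS n (by omega)
    simp only [H.sgdIterate_succ]
    have hJ := H.smooth.continuous_dualitySel H.conj.lt
    have hJd := continuous_dualitySelDual H.convex H.conj H.c_nonneg H.bregman_dual_le
    have hF := (H.continuousOn (i (n + 1)) _ hmem).tendsto.comp hin
    have hF' := (H.continuousOn_deriv (i (n + 1)) _ hmem).tendsto.comp hin
    have hj := (((H.smooth_codomain (i (n + 1))).continuous_dualitySel
      H.conj.lt).tendsto _).comp (hF.sub (hy (i (n + 1))))
    have hg : Tendsto (fun t => sgdGradient p F F' (yδ t) (sgdIterate p F F' (yδ t) μ x₀ i n)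
        (i (n + 1))) lf (𝓝 (sgdGradient p F F' y (sgdIterate p F F' y μ x₀ i n) (i (n + 1)))) :=
      (isBoundedBilinearMap_comp.continuous.tendsto _).comp (hj.prodMk_nhds hF')
    exact (hJd.tendsto _).comp (((hJ.tendsto _).comp hlim).sub (hg.const_smul _))

end SGDSetting

end Paths

/-! ### Functions of finitely many random indices. -/

section RandomIndices

variable {N : ℕ} {Ω : Type*} [MeasurableSpace Ω] {P : Measure Ω} {i : ℕ → Ω → Fin N}
  {α : Type*}

/-- The index sequence starting with given indices `1, ..., n`, and constant afterwards. -/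
def extendIndices (j₀ : Fin N) (n : ℕ) (t : Finset.range n → Fin N) (m : ℕ) : Fin N :=
  if h : m - 1 ∈ Finset.range n then t ⟨m - 1, h⟩ else j₀

theorem apply_extendIndices {g : (ℕ → Fin N) → α} {n : ℕ}
    (hg : DependsOn g (Set.Icc 1 n)) (j₀ : Fin N) (j : ℕ → Fin N) :
    g (extendIndices j₀ n fun m => j (m + 1)) = g j := by
  refine hg fun m hm => ?_
  have h1 : m - 1 ∈ Finset.range n := Finset.mem_range.2 (by have := hm.1; have := hm.2; omega)
  simp only [extendIndices, h1, dite_true]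
  rw [Nat.sub_add_cancel hm.1]

theorem measurable_indices (hi : ∀ n, 1 ≤ n → Measurable (i n)) (n : ℕ) :
    Measurable fun (s : Ω) (m : Finset.range n) => i (m + 1) s :=
  measurable_pi_lambda _ fun m => hi _ (by omega)

/-- Such a function factors through a finite set of index words, so no measurability of `g` is
required. -/
theorem integrable_of_dependsOn [IsFiniteMeasure P] (hi : ∀ n, 1 ≤ n → Measurable (i n))
    {g : (ℕ → Fin N) → ℝ} {n : ℕ} (hg : DependsOn g (Set.Icc 1 n)) :
    Integrable (fun s => g fun m => i m s) P := by
  rcases isEmpty_or_nonempty Ω with hΩ | ⟨⟨s₀⟩⟩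
  · rw [Subsingleton.elim P 0]
    exact integrable_zero_measure
  have j₀ := i 1 s₀
  have h1 : (fun s => g fun m => i m s) = (fun t => g (extendIndices j₀ n t)) ∘
      fun (s : Ω) (m : Finset.range n) => i (m + 1) s :=
    funext fun s => (apply_extendIndices hg j₀ fun m => i m s).symm
  rw [h1]
  have hm := measurable_indices hi n
  refine Integrable.of_finite.comp_measurable hm

/-- Conditioning on the first `n` indices: the index `n + 1` is uniform and independent. -/
theorem integral_apply_next_index [IsProbabilityMeasure P] (hi : ∀ n, 1 ≤ n → Measurable (i n))
    (hiunif : ∀ n, 1 ≤ n → ∀ j : Fin N, P {s | i n s = j} = (N : ENNReal)⁻¹)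
    (hiindep : iIndepFun (fun n : ℕ => i (n + 1)) P) {g : (ℕ → Fin N) → Fin N → ℝ} {n : ℕ}
    (hg : ∀ j, DependsOn (fun t => g t j) (Set.Icc 1 n)) :
    ∫ s, g (fun m => i m s) (i (n + 1) s) ∂P =
      (N : ℝ)⁻¹ * ∑ j, ∫ s, g (fun m => i m s) j ∂P := by
  classical
  obtain ⟨s₀⟩ := nonempty_of_isProbabilityMeasure P
  have j₀ := i 1 s₀
  have hind : IndepFun (fun (s : Ω) (m : Finset.range n) => i (m + 1) s) (i (n + 1)) P := by
    have h1 := hiindep.indepFun_finset (Finset.range n) {n} (by simp)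
      fun m => hi _ (by omega)
    exact h1.comp (φ := id) (ψ := fun t => t ⟨n, Finset.mem_singleton_self n⟩) measurable_id
      (measurable_of_finite _)
  have hterm : ∀ j, ∫ s, (g (fun m => i m s) j) * (if i (n + 1) s = j then 1 else 0) ∂P =
      (∫ s, g (fun m => i m s) j ∂P) * (N : ℝ)⁻¹ := fun j => by
    have h1 : ∀ s, g (fun m => i m s) j =
        g (extendIndices j₀ n fun m => i (m + 1) s) j :=
      fun s => (apply_extendIndices (hg j) j₀ fun m => i m s).symm
    have h2 : ∫ s, (if i (n + 1) s = j then (1 : ℝ) else 0) ∂P = (N : ℝ)⁻¹ := by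
      have h3 : (fun s => if i (n + 1) s = j then (1 : ℝ) else 0) =
          {s | i (n + 1) s = j}.indicator 1 := by
        ext s; simp [Set.indicator_apply]
      have h4 : MeasurableSet {s | i (n + 1) s = j} :=
        hi (n + 1) (by omega) (measurableSet_singleton j)
      rw [h3, integral_indicator_one h4, measureReal_def, hiunif _ (by omega)]
      simp
    simp only [h1]
    rw [← h2]
    exact hind.integral_fun_comp_mul_comp (f := fun t => g (extendIndices j₀ n t) j)
      (g := fun a => if a = j then (1 : ℝ) else 0) (measurable_indices hi n).aemeasurable
      (hi _ (by omega)).aemeasurable (measurable_of_finite _).aestronglyMeasurable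
      (measurable_of_finite _).aestronglyMeasurable
  have hsum : ∀ s, g (fun m => i m s) (i (n + 1) s) =
      ∑ j, (g (fun m => i m s) j) * (if i (n + 1) s = j then 1 else 0) := fun s => by simp
  simp only [hsum]
  rw [integral_finsetSum]
  · simp only [hterm]
    rw [← Finset.sum_mul, mul_comm]
  · intro j _
    refine integrable_of_dependsOn (n := n + 1) hi
      (g := fun t => g t j * (if t (n + 1) = j then 1 else 0)) fun t t' htt' => ?_
    have h1 := hg j (x := t) (y := t') fun m hm => htt' m ⟨hm.1, hm.2.trans n.le_succ⟩
    have h2 := htt' (n + 1) ⟨by omega, le_rfl⟩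
    simp only at h1 ⊢
    rw [h1, h2]

end RandomIndices

theorem le_add_sum_of_step {D μ : ℕ → ℝ} {T : ℝ} (hT : 0 ≤ T) (hμ : ∀ l, 1 ≤ l → 0 < μ l)
    {n : ℕ} (hstep : ∀ k < n, D (k + 1) ≤ D k + T * μ (k + 1)) {l k : ℕ} (hlk : l ≤ k)
    (hkn : k ≤ n) : D k ≤ D l + T * ∑ j ∈ Finset.Icc 1 n, μ j := by
  have h1 : D k ≤ D l + T * (∑ j ∈ Finset.Icc 1 k, μ j - ∑ j ∈ Finset.Icc 1 l, μ j) := by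
    induction k, hlk using Nat.le_induction with
    | base => simp
    | succ k hk ih =>
      rw [Finset.sum_Icc_succ_top (by omega)]
      have := ih (by omega)
      have := hstep k (by omega)
      linarith
  have h2 : ∑ j ∈ Finset.Icc 1 k, μ j ≤ ∑ j ∈ Finset.Icc 1 n, μ j :=
    Finset.sum_le_sum_of_subset_of_nonneg (Finset.Icc_subset_Icc le_rfl hkn)
      fun l hl _ => (hμ l (Finset.mem_Icc.1 hl).1).le
  have h3 : 0 ≤ ∑ j ∈ Finset.Icc 1 l, μ j :=
    Finset.sum_nonneg fun l hl => (hμ l (Finset.mem_Icc.1 hl).1).le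
  have h4 : T * (∑ j ∈ Finset.Icc 1 k, μ j - ∑ j ∈ Finset.Icc 1 l, μ j) ≤
      T * ∑ j ∈ Finset.Icc 1 n, μ j := by
    gcongr
    linarith
  linarith

/-! ### Convergence in expectation. -/

section Convergence

variable {X : Type*} [NormedAddCommGroup X] [NormedSpace ℝ X]
  {N : ℕ} {Y : Fin N → Type*} [∀ i, NormedAddCommGroup (Y i)] [∀ i, NormedSpace ℝ (Y i)]
  {p p' c γ Λ ν C : ℝ} {F : ∀ i, X → Y i} {F' : ∀ i, X → X →L[ℝ] Y i}
  {y : ∀ i, Y i} {S : Set X} {x₀ xs : X} {μ : ℕ → ℝ}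
  {Ω : Type*} [MeasurableSpace Ω] {P : Measure Ω} {i : ℕ → Ω → Fin N}

theorem integrable_comp_sgdIterate [IsFiniteMeasure P] (hi : ∀ n, 1 ≤ n → Measurable (i n))
    (y : ∀ i, Y i) (f : X → ℝ) (n : ℕ) :
    Integrable (fun s => f (sgdIterate p F F' y μ x₀ (fun m => i m s) n)) P :=
  integrable_of_dependsOn hi (g := fun j => f (sgdIterate p F F' y μ x₀ j n)) fun _ _ h =>
    congrArg f (sgdIterate_congr p F F' y μ x₀ h)

namespace SGDSetting

/-- For exact data, the iterates stay in `S` and the Bregman distance decreases along every path. -/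
theorem bregman_sgdIterate_exact (H : SGDSetting p p' c γ Λ ν F F' y S x₀ xs)
    [CompleteSpace X] (hC : 0 < C) (hμ : ∀ l, 1 ≤ l → 0 < μ l)
    (hμC : ∀ l, 1 ≤ l → C ≤ 1 - γ - Λ ^ p' * c * μ l ^ (p' - 1)) (i : ℕ → Fin N) (k : ℕ) :
    sgdIterate p F F' y μ x₀ i k ∈ S ∧ bregman p (sgdIterate p F F' y μ x₀ i k) xs ≤ ν ∧
      C / 2 * (μ (k + 1) * ‖F (i (k + 1)) (sgdIterate p F F' y μ x₀ i k) - y (i (k + 1))‖ ^ p) ≤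
        bregman p (sgdIterate p F F' y μ x₀ i k) xs -
          bregman p (sgdIterate p F F' y μ x₀ i (k + 1)) xs := by
  obtain ⟨M, hM, h⟩ := H.exists_bregman_sgdIterate_le hC hμ hμC
  have hex := fun n => h y 0 i n le_rfl (by simp)
    (by simpa [Real.zero_rpow H.conj.ne_zero] using H.bregman_lt.le)
  simp only [Real.zero_rpow H.conj.ne_zero, mul_zero, add_zero] at hex
  refine ⟨(hex k).1 k le_rfl, ?_, by linarith [(hex (k + 1)).2 k k.lt_succ_self]⟩
  refine le_trans ?_ H.bregman_lt.le
  have h1 := le_add_sum_of_step (D := fun k => bregman p (sgdIterate p F F' y μ x₀ i k) xs)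
    (T := 0) le_rfl hμ (n := k) (fun j hj => by
      have h2 := (hex k).2 j hj
      have := hμ (j + 1) (by omega)
      have h3 : 0 ≤ C / 2 * (μ (j + 1) * ‖F (i (j + 1)) (sgdIterate p F F' y μ x₀ i j) -
        y (i (j + 1))‖ ^ p) := by positivity
      linarith) (Nat.zero_le k) le_rfl
  simpa [sgdIterate] using h1

/-- Convergence in expectation for exact data. -/
theorem tendsto_integral_bregman_exact (H : SGDSetting p p' c γ Λ ν F F' y S x₀ xs)
    [CompleteSpace X] (hC : 0 < C) (hμ : ∀ l, 1 ≤ l → 0 < μ l)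
    (hμC : ∀ l, 1 ≤ l → C ≤ 1 - γ - Λ ^ p' * c * μ l ^ (p' - 1))
    (hμsum : Tendsto (fun n : ℕ => ∑ l ∈ Finset.Icc 1 n, μ l) atTop atTop)
    [IsProbabilityMeasure P] (hi : ∀ n, 1 ≤ n → Measurable (i n))
    (hiunif : ∀ n, 1 ≤ n → ∀ j : Fin N, P {s | i n s = j} = (N : ENNReal)⁻¹)
    (hiindep : iIndepFun (fun n : ℕ => i (n + 1)) P) :
    Tendsto (fun n => ∫ s, bregman p (sgdIterate p F F' y μ x₀ (fun m => i m s) n) xs ∂P)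
      atTop (𝓝 0) := by
  obtain ⟨s₀⟩ := nonempty_of_isProbabilityMeasure P
  have j₀ := i 1 s₀
  have hN : 0 < (N : ℝ) := by exact_mod_cast j₀.pos
  have hγ := H.γ_nonneg
  have hpath := fun j k => H.bregman_sgdIterate_exact hC hμ hμC j k
  set z : ℕ → Ω → X := fun n s => sgdIterate p F F' y μ x₀ (fun m => i m s) n
  set r : ℕ → Ω → ℝ := fun m s => ‖F (i (m + 1) s) (z m s) - y (i (m + 1) s)‖ ^ p
  set d : ℕ → ℝ := fun n => ∫ s, bregman p (z n s) xs ∂P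
  set e : ℕ → ℝ := fun n => ∫ s, residual p F y (z n s) ∂P with he
  have hintD : ∀ n, Integrable (fun s => bregman p (z n s) xs) P := fun n =>
    integrable_comp_sgdIterate hi y (fun x => bregman p x xs) n
  have hintR : ∀ n, Integrable (fun s => residual p F y (z n s)) P := fun n =>
    integrable_comp_sgdIterate hi y (residual p F y) n
  have hintr : ∀ n, Integrable (r n) P := fun n =>
    integrable_of_dependsOn (n := n + 1) hi (g := fun t =>
      ‖F (t (n + 1)) (sgdIterate p F F' y μ x₀ t n) - y (t (n + 1))‖ ^ p) fun t t' h => by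
        have h1 : t (n + 1) = t' (n + 1) := h (n + 1) ⟨by omega, le_rfl⟩
        have h2 := sgdIterate_congr p F F' y μ x₀ (n := n) fun m hm =>
          h m ⟨hm.1, hm.2.trans n.le_succ⟩
        simp only
        rw [h1, h2]
  have hre : ∀ n, ∫ s, r n s ∂P = (N : ℝ)⁻¹ * e n := fun n => by
    have h1 := integral_apply_next_index hi hiunif hiindep (n := n)
      (g := fun t j => ‖F j (sgdIterate p F F' y μ x₀ t n) - y j‖ ^ p) fun j t t' h => by
        simp only [sgdIterate_congr p F F' y μ x₀ h]
    refine h1.trans ?_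
    rw [he]
    simp only [residual]
    rw [integral_finsetSum _ fun j _ => integrable_comp_sgdIterate hi y
      (fun x => ‖F j x - y j‖ ^ p) n]
  have hκ : 0 < C / 2 * (N : ℝ)⁻¹ := by positivity
  have he0 : ∀ n, 0 ≤ e n := fun n => integral_nonneg fun s => residual_nonneg p F y _
  have hstep : ∀ n, C / 2 * (N : ℝ)⁻¹ * (μ (n + 1) * e n) ≤ d n - d (n + 1) := fun n => by
    have h1 : ∫ s, C / 2 * (μ (n + 1) * r n s) ∂P ≤
        ∫ s, (bregman p (z n s) xs - bregman p (z (n + 1) s) xs) ∂P :=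
      integral_mono (((hintr n).const_mul _).const_mul _) ((hintD n).sub (hintD (n + 1)))
        fun s => (hpath (fun m => i m s) n).2.2
    rw [integral_sub (hintD n) (hintD (n + 1)), integral_const_mul, integral_const_mul, hre] at h1
    calc _ = C / 2 * (μ (n + 1) * ((N : ℝ)⁻¹ * e n)) := by ring
      _ ≤ _ := h1
  -- `A` is the ratio of the factor of `μ (m + 1) * e m` in the gradient sum, once `e k ≤ e m` is
  -- used, to the factor in the decrease `hstep`.
  refine tendsto_zero_of_le_at_running_minima (e := e) (μ := μ)
    (A := (1 + γ) * (3 * (N : ℝ)⁻¹ + 1) / (C / 2 * (N : ℝ)⁻¹)) hκ (by positivity)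
    (fun n => integral_nonneg fun s => bregman_nonneg H.conj _ _) he0 hμ hμsum hstep ?_
  intro l ε hε
  obtain ⟨B, hB⟩ := norm_le_of_bregman_le H.conj xs ν
  -- The functional at time `l` is random but takes finitely many values, one per index word, so the
  -- sum of the constants works for every path.
  have hQ : ∀ t : Finset.range l → Fin N, ∃ Q : ℝ, 0 ≤ Q ∧ ∀ x ∈ S, ‖x - xs‖ ≤ B + ‖xs‖ →
      (dualitySel p (sgdIterate p F F' y μ x₀ (extendIndices j₀ l t) l) - dualitySel p xs)
        (x - xs) ≤ ε + Q * residual p F y x := fun t =>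
    H.exists_apply_sub_le (fun h hh => H.dualitySel_sgdIterate_sub_apply_eq_zero y μ _ l
      (fun m _ => (hpath _ m).1) hh) _ hε
  choose Q hQ0 hQ using hQ
  refine ⟨∑ t, Q t, Finset.sum_nonneg fun t _ => hQ0 t, fun k hlk hmin => ?_⟩
  have hfirst : ∀ s, (dualitySel p (z l s) - dualitySel p xs) (z k s - xs) ≤
      ε + (∑ t, Q t) * residual p F y (z k s) := fun s => by
    have hmem := hpath (fun m => i m s) k
    have h1 := hQ (fun m => i (m + 1) s) (z k s) hmem.1
      ((norm_sub_le _ _).trans (by gcongr; exact hB _ hmem.2.1))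
    have h2 : sgdIterate p F F' y μ x₀ (extendIndices j₀ l fun m => i (m + 1) s) l = z l s :=
      apply_extendIndices (g := fun t => sgdIterate p F F' y μ x₀ t l)
        (fun _ _ h => sgdIterate_congr p F F' y μ x₀ h) j₀ fun m => i m s
    rw [h2] at h1
    have h3 : Q (fun m => i (m + 1) s) ≤ ∑ t, Q t :=
      Finset.single_le_sum (fun t _ => hQ0 t) (Finset.mem_univ _)
    have h4 := mul_le_mul_of_nonneg_right h3 (residual_nonneg p F y (z k s))
    linarith
  have hpt : ∀ s, bregman p (z k s) xs ≤ (ε + (∑ t, Q t) * residual p F y (z k s)) +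
      ∑ m ∈ Finset.Ico l k, μ (m + 1) * ((1 + γ) *
        (3 * r m s + residual p F y (z k s))) := fun s => by
    have h1 := bregman_le_sub_apply_sub H.conj (z k s) xs
    have h2 := H.dualitySel_sgdIterate_sub_apply_le hμ (fun m => i m s)
      (fun m => (hpath _ m).1) hlk
    have h3 := hfirst s
    have h4 : (dualitySel p (z k s) - dualitySel p xs) (z k s - xs) =
        (dualitySel p (z l s) - dualitySel p xs) (z k s - xs) +
        (dualitySel p (z k s) - dualitySel p (z l s)) (z k s - xs) := by
      simp only [sub_apply]; ring
    exact h1.trans (h4.trans_le (add_le_add h3 h2))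
  have hterm : ∀ m, Integrable (fun s => μ (m + 1) * ((1 + γ) *
      (3 * r m s + residual p F y (z k s)))) P := fun m =>
    ((((hintr m).const_mul 3).add (hintR k)).const_mul _).const_mul _
  have hfirstI : Integrable (fun s => ε + (∑ t, Q t) * residual p F y (z k s)) P :=
    (integrable_const ε).add ((hintR k).const_mul _)
  have hsumI : Integrable (fun s => ∑ m ∈ Finset.Ico l k, μ (m + 1) * ((1 + γ) *
      (3 * r m s + residual p F y (z k s)))) P := integrable_finsetSum _ fun m _ => hterm m
  have hI : d k ≤ (ε + (∑ t, Q t) * e k) + ∑ m ∈ Finset.Ico l k, μ (m + 1) * ((1 + γ) *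
      (3 * ((N : ℝ)⁻¹ * e m) + e k)) := by
    refine (integral_mono (hintD k) (hfirstI.add hsumI) hpt).trans_eq ?_
    rw [integral_add' hfirstI hsumI, integral_add (integrable_const ε) ((hintR k).const_mul _),
      integral_const, integral_const_mul, integral_finsetSum _ fun m _ => hterm m]
    simp only [probReal_univ, one_smul]
    congr 1
    refine Finset.sum_congr rfl fun m _ => ?_
    rw [integral_const_mul, integral_const_mul,
      integral_add ((hintr m).const_mul 3) (hintR k), integral_const_mul, hre]
  have hsum : ∑ m ∈ Finset.Ico l k, μ (m + 1) * ((1 + γ) * (3 * ((N : ℝ)⁻¹ * e m) + e k)) ≤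
      ∑ m ∈ Finset.Ico l k,
        (1 + γ) * (3 * (N : ℝ)⁻¹ + 1) / (C / 2 * (N : ℝ)⁻¹) * (d m - d (m + 1)) := by
    refine Finset.sum_le_sum fun m hm => ?_
    obtain ⟨hm1, hm2⟩ := Finset.mem_Ico.1 hm
    have h1 := hmin m hm1 hm2
    have h2 := hμ (m + 1) (by omega)
    calc μ (m + 1) * ((1 + γ) * (3 * ((N : ℝ)⁻¹ * e m) + e k))
        ≤ μ (m + 1) * ((1 + γ) * (3 * ((N : ℝ)⁻¹ * e m) + e m)) := by gcongr
      _ = (1 + γ) * (3 * (N : ℝ)⁻¹ + 1) / (C / 2 * (N : ℝ)⁻¹) *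
          (C / 2 * (N : ℝ)⁻¹ * (μ (m + 1) * e m)) := by field_simp
      _ ≤ _ := mul_le_mul_of_nonneg_left (hstep m) (by positivity)
  have htel : ∑ m ∈ Finset.Ico l k, (d m - d (m + 1)) = d l - d k := by
    rw [← neg_sub (d k), ← Finset.sum_Ico_sub d hlk, ← Finset.sum_neg_distrib]
    simp only [neg_sub]
  rw [← Finset.mul_sum, htel] at hsum
  exact hI.trans (by linarith)

/-- Convergence in expectation for noisy data, with a suitable choice of the stopping index. -/
theorem tendsto_integral_bregman_noisy (H : SGDSetting p p' c γ Λ ν F F' y S x₀ xs)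
    [CompleteSpace X] (hC : 0 < C) (hμ : ∀ l, 1 ≤ l → 0 < μ l)
    (hμC : ∀ l, 1 ≤ l → C ≤ 1 - γ - Λ ^ p' * c * μ l ^ (p' - 1))
    (hμsum : Tendsto (fun n : ℕ => ∑ l ∈ Finset.Icc 1 n, μ l) atTop atTop)
    {yδ : ℝ → ∀ i, Y i} (hyδ : ∀ δ, 0 < δ → ∀ i, ‖y i - yδ δ i‖ ≤ δ)
    {k : ℝ → ℕ} (hk : Tendsto k (𝓝[>] 0) atTop)
    (hkμ : Tendsto (fun δ : ℝ => δ ^ p * ∑ l ∈ Finset.Icc 1 (k δ), μ l) (𝓝[>] 0) (𝓝 0))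
    [IsProbabilityMeasure P] (hi : ∀ n, 1 ≤ n → Measurable (i n))
    (hiunif : ∀ n, 1 ≤ n → ∀ j : Fin N, P {s | i n s = j} = (N : ENNReal)⁻¹)
    (hiindep : iIndepFun (fun n : ℕ => i (n + 1)) P) :
    Tendsto (fun δ : ℝ => ∫ s,
      bregman p (sgdIterate p F F' (yδ δ) μ x₀ (fun n => i n s) (k δ)) xs ∂P)
      (𝓝[>] 0) (𝓝 0) := by
  obtain ⟨M, hM, hstep⟩ := H.exists_bregman_sgdIterate_le hC hμ hμC
  have hMlim : Tendsto (fun δ : ℝ => M * (δ ^ p * ∑ l ∈ Finset.Icc 1 (k δ), μ l)) (𝓝[>] 0)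
      (𝓝 0) := by simpa using hkμ.const_mul M
  have hpos : ∀ᶠ δ : ℝ in 𝓝[>] 0, 0 < δ := self_mem_nhdsWithin
  have hsmall : ∀ᶠ δ : ℝ in 𝓝[>] 0,
      bregman p x₀ xs + M * (δ ^ p * ∑ l ∈ Finset.Icc 1 (k δ), μ l) ≤ ν := by
    filter_upwards [hMlim.eventually (gt_mem_nhds (sub_pos.2 H.bregman_lt))] with δ hδ
    linarith
  have hmono : ∀ᶠ δ : ℝ in 𝓝[>] 0, ∀ (j : ℕ → Fin N) (l m : ℕ), l ≤ m → m ≤ k δ →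
      bregman p (sgdIterate p F F' (yδ δ) μ x₀ j m) xs ≤
        bregman p (sgdIterate p F F' (yδ δ) μ x₀ j l) xs +
          M * (δ ^ p * ∑ l ∈ Finset.Icc 1 (k δ), μ l) := by
    filter_upwards [hsmall, hpos] with δ hδ hδ0 j l m hlm hmk
    have h1 := (hstep (yδ δ) δ j (k δ) hδ0.le (hyδ δ hδ0) hδ).2
    rw [← mul_assoc]
    refine le_add_sum_of_step (D := fun m => bregman p (sgdIterate p F F' (yδ δ) μ x₀ j m) xs)
      (by positivity) hμ (fun q hq => ?_) hlm hmk
    have h2 := h1 q hq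
    have := hμ (q + 1) (by omega)
    have h3 : 0 ≤ C / 2 * (μ (q + 1) * ‖F (j (q + 1)) (sgdIterate p F F' (yδ δ) μ x₀ j q) -
      yδ δ (j (q + 1))‖ ^ p) := by positivity
    linarith
  have hyδlim : ∀ j, Tendsto (fun δ => yδ δ j) (𝓝[>] 0) (𝓝 (y j)) := fun j => by
    rw [tendsto_iff_norm_sub_tendsto_zero]
    refine squeeze_zero' (.of_forall fun _ => norm_nonneg _) ?_
      (tendsto_id.mono_left nhdsWithin_le_nhds)
    filter_upwards [hpos] with δ hδ
    rw [norm_sub_rev]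
    exact hyδ δ hδ j
  have hfix : ∀ n, Tendsto (fun δ : ℝ => ∫ s,
      bregman p (sgdIterate p F F' (yδ δ) μ x₀ (fun m => i m s) n) xs ∂P) (𝓝[>] 0)
      (𝓝 (∫ s, bregman p (sgdIterate p F F' y μ x₀ (fun m => i m s) n) xs ∂P)) := fun n => by
    refine tendsto_integral_filter_of_dominated_convergence (fun _ => ν) (.of_forall fun δ =>
      (integrable_comp_sgdIterate hi (yδ δ) (fun x => bregman p x xs) n).aestronglyMeasurable)
      ?_ (integrable_const ν) (.of_forall fun s => ?_)
    · filter_upwards [hmono, hsmall, hk.eventually_ge_atTop n] with δ h1 h2 h3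
      refine .of_forall fun s => ?_
      rw [Real.norm_of_nonneg (bregman_nonneg H.conj _ _)]
      exact (h1 (fun m => i m s) 0 n (Nat.zero_le n) h3).trans h2
    · refine ((H.smooth.continuous_bregman_left H.conj xs).tendsto _).comp
        (H.tendsto_sgdIterate hyδlim _ (fun q _ =>
          (H.bregman_sgdIterate_exact hC hμ hμC _ q).1) fun q _ => ?_)
      filter_upwards [hsmall, hpos, hk.eventually_ge_atTop q] with δ h1 h2 h3
      exact (hstep (yδ δ) δ _ (k δ) h2.le (hyδ δ h2) h1).1 q h3
  refine Metric.tendsto_nhds.2 fun ε hε => ?_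
  have hexact := H.tendsto_integral_bregman_exact hC hμ hμC hμsum hi hiunif hiindep
  -- `n` is fixed before `δ`: stability is only available for a fixed number of steps, and
  -- near-monotonicity covers the rest up to `k δ`.
  obtain ⟨n, hn⟩ := (hexact.eventually (gt_mem_nhds (half_pos hε))).exists
  filter_upwards [hmono, (hfix n).eventually (gt_mem_nhds hn), hk.eventually_ge_atTop n,
    hMlim.eventually (gt_mem_nhds (half_pos hε))] with δ h1 h2 h3 h4
  have hint := fun q => integrable_comp_sgdIterate (p := p) (F := F) (F' := F') (μ := μ)
    (x₀ := x₀) (P := P) hi (yδ δ) (fun x => bregman p x xs) q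
  have h5 := integral_mono (hint (k δ)) ((hint n).add (integrable_const _))
    fun s => h1 (fun m => i m s) n (k δ) h3 le_rfl
  rw [integral_add' (hint n) (integrable_const _), integral_const, probReal_univ, one_smul] at h5
  rw [Real.dist_eq, sub_zero, abs_of_nonneg (integral_nonneg fun s => bregman_nonneg H.conj _ _)]
  linarith

end SGDSetting

end Convergence

end SGDBanach

theorem mainTheorem3
    {X : Type*} [NormedAddCommGroup X] [NormedSpace ℝ X] [CompleteSpace X]
    {N : ℕ} {Y : Fin N → Type*} [∀ i, NormedAddCommGroup (Y i)] [∀ i, NormedSpace ℝ (Y i)]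
    [∀ i, CompleteSpace (Y i)]
    -- exponents and geometry of the spaces
    (p p' : ℝ) (hpp' : p.HolderConjugate p')
    (hX : SGDBanach.IsPConvex p X) (hX' : SGDBanach.IsUniformlySmooth X)
    (hY : ∀ i, SGDBanach.IsUniformlySmooth (Y i))
    -- the constant of the upper Bregman bound in the dual space
    (G : ℝ) (hG : 0 < G)
    (hGbound : ∀ ξ η : StrongDual ℝ X, SGDBanach.bregman p' ξ η ≤ G / p' * ‖η - ξ‖ ^ p')
    -- forward operators, exact data, the set `S`, and the reference solution
    (F : ∀ i, X → Y i) (F' : ∀ i, X → X →L[ℝ] Y i) (y : ∀ i, Y i)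
    (S : Set X) (hSclosed : IsClosed S) (hSconvex : Convex ℝ S)
    (x₀ xs : X) (hxs : SGDBanach.IsMinDistSolution p S F y x₀ xs)
    -- the Bregman ball
    (γ ω Γ ν : ℝ) (hγ : 0 < γ) (hγ' : γ < 1 / 2) (hω : 0 < ω)
    (hν : ν = SGDBanach.bregman p x₀ xs + ω ^ (-p) / p * (1 + γ) ^ p * Γ)
    (hball : SGDBanach.bregmanBall p ν xs ⊆ S)
    -- continuous differentiability, bounded derivatives, tangential cone condition
    (hF' : ∀ i, ∀ x ∈ S, HasFDerivWithinAt (F i) (F' i x) S x)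
    (hF'cont : ∀ i, ContinuousOn (F' i) S)
    (L : Fin N → ℝ) (hL : ∀ i, ∀ x ∈ S, ‖F' i x‖ ≤ L i)
    (hTCC : ∀ i, ∀ x ∈ S, ∀ x' ∈ S,
      ‖F i x - F i x' - F' i x (x - x')‖ ≤ γ * ‖F i x - F i x'‖)
    -- weak continuity and the null-space condition for `F' = (F'_1, ..., F'_N)`
    (hFweak : ∀ i, SGDBanach.WeakToWeakContinuousOn (F i) S)
    (hnull : ∀ x ∈ S, ∀ h : X, (∀ i, F' i xs h = 0) → ∀ i, F' i x h = 0)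
    -- step sizes `μ 1, μ 2, ...`
    (μ : ℕ → ℝ) (hμ : ∀ l, 1 ≤ l → 0 < μ l)
    (hμsum : Tendsto (fun n : ℕ => ∑ l ∈ Finset.Icc 1 n, μ l) atTop atTop)
    (C : ℝ) (hC : 0 < C)
    (hμC : ∀ l, 1 ≤ l →
      C ≤ 1 - γ - (⨆ i, L i) ^ p' * (G / p') * μ l ^ (p' - 1) - (p - 1) / p ^ 2 * ω ^ p')
    -- noisy data and stopping indices
    (yδ : ℝ → ∀ i, Y i) (hyδ : ∀ δ, 0 < δ → ∀ i, ‖y i - yδ δ i‖ ≤ δ)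
    (k : ℝ → ℕ) (hk : Tendsto k (𝓝[>] 0) atTop)
    (hkΓ : ∀ᶠ δ in 𝓝[>] (0 : ℝ), δ ^ p * ∑ l ∈ Finset.Icc 1 (k δ), μ l ≤ Γ)
    (hkμ : Tendsto (fun δ : ℝ => δ ^ p * ∑ l ∈ Finset.Icc 1 (k δ), μ l) (𝓝[>] 0) (𝓝 0))
    -- independent, uniformly distributed indices `i 1, i 2, ...`
    {Ω : Type*} [MeasurableSpace Ω] (P : Measure Ω) [IsProbabilityMeasure P]
    (i : ℕ → Ω → Fin N) (hi : ∀ n, 1 ≤ n → Measurable (i n))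
    (hiunif : ∀ n, 1 ≤ n → ∀ j : Fin N, P {s | i n s = j} = (N : ENNReal)⁻¹)
    (hiindep : iIndepFun (fun n : ℕ => i (n + 1)) P) :
    (∀ δ, 0 < δ → Integrable (fun s =>
      SGDBanach.bregman p
        (SGDBanach.sgdIterate p F F' (yδ δ) μ x₀ (fun n => i n s) (k δ)) xs) P) ∧
    Tendsto (fun δ : ℝ => ∫ s,
      SGDBanach.bregman p
        (SGDBanach.sgdIterate p F F' (yδ δ) μ x₀ (fun n => i n s) (k δ)) xs ∂P)
      (𝓝[>] 0) (𝓝 0) := by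
  refine ⟨fun δ _ => SGDBanach.integrable_comp_sgdIterate hi (yδ δ)
    (fun x => SGDBanach.bregman p x xs) (k δ), ?_⟩
  have hp := hpp'.pos
  have hp' := hpp'.symm.pos
  -- `Γ` dominates a positive noise sum. Hence `ν` strictly exceeds the initial distance, which
  -- leaves room for any noise contribution tending to zero.
  have hΓ : 0 < Γ := by
    have hpos : ∀ᶠ δ : ℝ in 𝓝[>] 0, 0 < δ := self_mem_nhdsWithin
    obtain ⟨δ, h1, h2, h3⟩ := (hkΓ.and (hpos.and (hk.eventually_ge_atTop 1))).exists
    refine lt_of_lt_of_le (mul_pos (Real.rpow_pos_of_pos h2 p) ?_) h1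
    exact Finset.sum_pos (fun l hl => hμ l (Finset.mem_Icc.1 hl).1)
      ⟨1, Finset.mem_Icc.2 ⟨le_rfl, h3⟩⟩
  have hνlt : SGDBanach.bregman p x₀ xs < ν := by
    rw [hν, lt_add_iff_pos_right]
    positivity
  have H : SGDBanach.SGDSetting p p' (G / p') γ (⨆ i, L i) ν F F' y S x₀ xs :=
    { conj := hpp'
      convex := hX
      smooth := hX'
      smooth_codomain := hY
      c_nonneg := by positivity
      bregman_dual_le := hGbound
      isSolution := hxs
      γ_nonneg := hγ.le
      γ_lt_one := by linarith
      bregman_lt := hνlt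
      ball_subset := hball
      continuousOn := fun i x hx => (hF' i x hx).continuousWithinAt
      continuousOn_deriv := hF'cont
      norm_deriv_le := fun i x hx =>
        (hL i x hx).trans (le_ciSup (Set.finite_range L).bddAbove i)
      cone := hTCC
      null := hnull }
  refine H.tendsto_integral_bregman_noisy hC hμ (fun l hl => (hμC l hl).trans ?_) hμsum hyδ hk hkμ
    hi hiunif hiindep
  have h1 : 0 ≤ (p - 1) / p ^ 2 * ω ^ p' := by
    have := hpp'.sub_one_pos
    positivity
  linarith
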